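/- Let $K$ be a field of characteristic zero and $V$ a finite-dimensional $K$-vector space. Filtrations $W=(W_k)_{k\in\mathbb Z}$ of $V$ are increasing and finite ($W_k=0$ for $k\ll0$, $W_k=V$ for $k\gg0$). A grading of $W$ is a diagonalizable $Y\in\mathrm{End}(V)$ with integral eigenvalues such that $W_k=\bigoplus_{j\le k}E_j(Y)$ for all $k$, where $E_j(Y)$ is the $j$-eigenspace. For a nilpotent $N$ preserving $W$, the relative weight filtration $M(N,W)$ is the (at most one) filtration $M$ with $N(M_k)\subseteq M_{k-2}$ such that $N^\ell:Gr^M_{k+\ell}Gr^W_k\to Gr^M_{k-\ell}Gr^W_k$ is an isomorphism for all $k\in\mathbb Z$, $\ell\ge0$. An $r$-variable Deligne system $(W,N_1,\dots,N_r,Y^r)$ on $V$ consists of a filtration $W=W^0$ and endomorphisms $N_1,\dots,N_r,Y^r$ of $V$ for which there are filtrations $W^1,\dots,W^r$ such that $Y^r$ is a grading of $W^r$ and (a) $N_1,\dots,N_r$ are nilpotent, commute and preserve $W^0$; (b) $M(N_j,W^{j-1})$ exists and equals $W^j$ for $1\le j\le r$; (c) for $1\le j\le r$, $0\le k<j-1$,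 $\ell\in\mathbb Z$ and $U=W^k_\ell$, the filtration $W^j|_U$ is the relative weight filtration of $N_j|_U$ with respect to $W^{j-1}|_U$; (d) $N_j(W^k_\ell)\subseteq W^k_\ell$ for all $j,k,\ell$, and $N_j(W^k_\ell)\subseteq W^k_{\ell-2}$ if $k\ge j$; (e) $Y^r$ preserves each $W^j$, and $[Y^r,N_j]=-2N_j$ for all $j$. For $j=r,\dots,1$ let $Y^{j-1}$ be the grading of $W^{j-1}$ attached to $(W^{j-1},N_j,Y^j)$ by Deligne: the unique grading of $W^{j-1}$ that commutes with $Y^j$ and satisfies $[N_j-\hat N_j,\hat N_j^+]=0$, where $\hat N_j$ is the degree-zero part of $N_j$ with respect to $\mathrm{ad}\,Y^{j-1}$, $H_j=Y^j-Y^{j-1}$, and $\hat N_j^+$ is the endomorphism completing $(\hat N_j,H_j)$ to an $\mathfrak{sl}_2$-triple: $[\hat N_j^+,\hat N_j]=H_j$, $[H_j,\hat N_j^+]=2\hat N_j^+$, $[H_j,\hat N_j]=-2\hat N_j$. The $\mathfrak{sl}_2$-type of the system is $(W,\hat N_1,H_1,\dots,\hat N_r,H_r)$. Theorem. For every fixed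 $(W,\hat N_1,H_1,\dots,\hat N_r,H_r)$, the set $\mathcal S$ of all $r$-variable Deligne systems $(W,N_1,\dots,N_r,Y^r)$ on $V$ of this $\mathfrak{sl}_2$-type is an affine algebraic variety over $K$ (possibly reducible or empty): as a subset of $\mathrm{End}(V)^{r}\times\mathrm{End}(V)$, via $(W,N_1,\dots,N_r,Y^r)\mapsto(N_1,\dots,N_r,Y^r)$, it is the zero locus of a set of polynomials with coefficients in $K$. -/

import Mathlib

namespace DeligneSys

variable {K : Type*} [Field K] {V : Type*} [AddCommGroup V] [Module K V]

/-- `W` is a finite increasing filtration of `V`, indexed by the integers. -/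
structure IsFiltration (W : ℤ → Submodule K V) : Prop where
  mono : Monotone W
  separated : ∃ a, W a = ⊥
  exhaustive : ∃ b, W b = ⊤

/-- `Y` is a grading of `W`: a diagonalizable endomorphism with integral eigenvalues such that
`W k` is the sum (automatically direct) of the eigenspaces `E_j(Y)` with `j ≤ k`. -/
structure IsGrading (Y : Module.End K V) (W : ℤ → Submodule K V) : Prop where
  diagonalizable : ⨆ j : ℤ, Module.End.eigenspace Y (j : K) = ⊤
  filtration_eq : ∀ k : ℤ, W k = ⨆ j : ℤ, ⨆ _ : j ≤ k, Module.End.eigenspace Y (j : K)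

/-- `f` maps `A` to `B` and `A'` to `B'`, and the induced map `A / A' → B / B'` is bijective
(`A'` and `B'` are meant to be submodules of `A` and `B`). -/
def InducesIso (f : Module.End K V) (A A' B B' : Submodule K V) : Prop :=
  ∃ (h : ∀ x ∈ A, f x ∈ B)
    (h' : A'.submoduleOf A ≤ (B'.submoduleOf B).comap (f.restrict h)),
    Function.Bijective (Submodule.mapQ (A'.submoduleOf A) (B'.submoduleOf B) (f.restrict h) h')

/-- The preimage in `W k` of the `m`-th step of the filtration which `M` induces on
`Gr^W_k = W k / W (k - 1)`. Hence `Gr^M_m Gr^W_k` is `grStep M W m k / grStep M W (m - 1) k`. -/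
def grStep (M W : ℤ → Submodule K V) (m k : ℤ) : Submodule K V :=
  (M m ⊓ W k) ⊔ W (k - 1)

/-- `M` is the relative weight filtration `M(N, W)` of `N` with respect to `W`. -/
structure IsRelativeWeightFiltration (N : Module.End K V) (W M : ℤ → Submodule K V) : Prop where
  filtration : IsFiltration M
  lowers : ∀ k : ℤ, ∀ x ∈ M k, N x ∈ M (k - 2)
  /-- `N ^ l : Gr^M_{k+l} Gr^W_k → Gr^M_{k-l} Gr^W_k` is an isomorphism. -/
  iso : ∀ (k : ℤ) (l : ℕ), InducesIso (N ^ l)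
    (grStep M W (k + l) k) (grStep M W (k + l - 1) k)
    (grStep M W (k - l) k) (grStep M W (k - l - 1) k)

/-- The filtration induced on a subspace `U`. -/
def restrictFiltration (W : ℤ → Submodule K V) (U : Submodule K V) : ℤ → Submodule K U :=
  fun k => (W k).submoduleOf U

/-- The defining conditions of a several-variable Deligne system, on filtrations `W^0, …, W^r`,
endomorphisms `N_1, …, N_r` and an endomorphism `Y = Y^r`. Here `N j` (for `j : Fin r`) is the endomorphism written `N_{j+1}`, so that
`W j.castSucc` and `W j.succ` are the filtrations just before and just after it. -/
structure IsDeligneData {r : ℕ} (W : Fin (r + 1) → ℤ → Submodule K V)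
    (N : Fin r → Module.End K V) (Y : Module.End K V) : Prop where
  filtration : ∀ k, IsFiltration (W k)
  grading : IsGrading Y (W (Fin.last r))
  nilpotent : ∀ j, IsNilpotent (N j)
  commute : ∀ i j, Commute (N i) (N j)
  relative : ∀ j, IsRelativeWeightFiltration (N j) (W j.castSucc) (W j.succ)
  stable : ∀ (j : Fin r) (k : Fin (r + 1)) (l : ℤ), ∀ x ∈ W k l, N j x ∈ W k l
  lowers : ∀ (j : Fin r) (k : Fin (r + 1)) (l : ℤ), j.succ ≤ k → ∀ x ∈ W k l, N j x ∈ W k (l - 2)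
  /-- On `U = W^k_l` with `k < j - 1`, the filtration `W^j` restricts to the relative weight
  filtration of the restrictions of `N_j` and `W^{j-1}`. -/
  relative_restrict : ∀ (j : Fin r) (k : Fin (r + 1)) (l : ℤ), k < j.castSucc →
    IsRelativeWeightFiltration ((N j).restrict (stable j k l))
      (restrictFiltration (W j.castSucc) (W k l)) (restrictFiltration (W j.succ) (W k l))
  grading_stable : ∀ (k : Fin (r + 1)) (l : ℤ), ∀ x ∈ W k l, Y x ∈ W k l
  grading_lie : ∀ j, ⁅Y, N j⁆ = (-2 : K) • N j

/-- `(W, N_1, …, N_r, Y)` is an `r`-variable Deligne system. (The filtrations `W^1, …, W^r` are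
determined by `W^0 = W` and the `N j`.) -/
def IsDeligneSystem {r : ℕ} (W : ℤ → Submodule K V) (N : Fin r → Module.End K V)
    (Y : Module.End K V) : Prop :=
  ∃ Ws : Fin (r + 1) → ℤ → Submodule K V, Ws 0 = W ∧ IsDeligneData Ws N Y

/-- `N₀` is the degree zero part of `N` in its decomposition into eigencomponents of `ad Y`. -/
def IsZeroComponent (Y N N₀ : Module.End K V) : Prop :=
  ∃ c : ℤ →₀ Module.End K V, (∀ n : ℤ, ⁅Y, c n⁆ = (n : K) • c n) ∧
    (c.sum fun _ A => A) = N ∧ c 0 = N₀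

/-- The relations `[N⁺, N] = H`, `[H, N⁺] = 2 N⁺`, `[H, N] = -2 N`, i.e. `(N, H, N⁺)` comes from a
representation of `sl₂` (possibly trivial, which is why `IsSl2Triple` is not used here).
In finite dimension and characteristic zero `N⁺` is determined by `N` and `H`. -/
structure IsSl2Rep (N H Np : Module.End K V) : Prop where
  lie_pos_neg : ⁅Np, N⁆ = H
  lie_cartan_pos : ⁅H, Np⁆ = (2 : K) • Np
  lie_cartan_neg : ⁅H, N⁆ = (-2 : K) • N

/-- `Y'` is the grading of `W` which Deligne's construction attaches to the one-variable Deligne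
system `(W, N, Y)`: it commutes with `Y` and, with `N₀` the degree zero part of `N` for `ad Y'` and
`(N₀, Y - Y', N₀⁺)` the associated `sl₂`-triple, `[N - N₀, N₀⁺] = 0`. -/
def IsDeligneGrading (W : ℤ → Submodule K V) (N Y Y' : Module.End K V) : Prop :=
  IsGrading Y' W ∧ Commute Y' Y ∧
    ∃ N₀ Np : Module.End K V, IsZeroComponent Y' N N₀ ∧ IsSl2Rep N₀ (Y - Y') Np ∧ ⁅N - N₀, Np⁆ = 0

/-- `(W, N_1, …, N_r, Y)` is a Deligne system of `sl₂`-type `(W, Nhat_1, H_1, …, Nhat_r, H_r)`: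
with `Y^r = Y` and `Y^{j-1}` obtained from `(W^{j-1}, N_j, Y^j)` by Deligne's construction,
`Nhat_j` is the degree zero part of `N_j` for `ad Y^{j-1}`, and `H_j = Y^j - Y^{j-1}`. -/
def IsDeligneSystemOfType {r : ℕ} (W : ℤ → Submodule K V) (Nhat H : Fin r → Module.End K V)
    (N : Fin r → Module.End K V) (Y : Module.End K V) : Prop :=
  ∃ (Ws : Fin (r + 1) → ℤ → Submodule K V) (Ys : Fin (r + 1) → Module.End K V),
    Ws 0 = W ∧ IsDeligneData Ws N Y ∧ Ys (Fin.last r) = Y ∧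
    ∀ j : Fin r, IsDeligneGrading (Ws j.castSucc) (N j) (Ys j.succ) (Ys j.castSucc) ∧
      IsZeroComponent (Ys j.castSucc) (N j) (Nhat j) ∧ H j = Ys j.succ - Ys j.castSucc

theorem IsDeligneSystemOfType.isDeligneSystem {r : ℕ} {W : ℤ → Submodule K V}
    {Nhat H N : Fin r → Module.End K V} {Y : Module.End K V}
    (h : IsDeligneSystemOfType W Nhat H N Y) : IsDeligneSystem W N Y := by
  obtain ⟨Ws, _, h0, hd, _⟩ := h
  exact ⟨Ws, h0, hd⟩

/-- The set of all Deligne systems of a given `sl₂`-type, as a subset of the vector space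
`End(V)^r × End(V)`; a point is `((N_1, …, N_r), Y^r)`. -/
def deligneSystemsOfType {r : ℕ} (W : ℤ → Submodule K V) (Nhat H : Fin r → Module.End K V) :
    Set ((Fin r → Module.End K V) × Module.End K V) :=
  {p | IsDeligneSystemOfType W Nhat H p.1 p.2}

/-- A subset of a finite-dimensional vector space is an (affine, not necessarily irreducible)
algebraic variety: in linear coordinates it is the zero locus of an ideal of polynomials. -/
def IsAlgebraicSubvariety {E : Type*} [AddCommGroup E] [Module K E] [FiniteDimensional K E]
    (S : Set E) : Prop :=
  ∃ I : Ideal (MvPolynomial (Fin (Module.finrank K E)) K),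
    (Module.finBasis K E).equivFun '' S = MvPolynomial.zeroLocus K I

end DeligneSys

/-! The set may be empty; otherwise fix one point of it. Since `H_j = Y^j - Y^{j-1}`, every
intermediate grading is `Y^k = Y^r - ∑_{i>k} H_i`, an affine function of the coordinate `Y^r`. Its
eigenvalues are bounded independently of the system: those of `Y^0` are jumps of the fixed `W`, and
`Y^k` is obtained from `Y^0` by adding the commuting fixed operators `H_1, …, H_k`. So the
eigenprojectors of all `Y^k` are fixed polynomials in `Y^k`. That an operator preserves `W^k`, or
lowers it by 2, means that certain products (projector) · (operator) · (projector) vanish, which is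
a polynomial condition. The element `Nhat_j^+` depends only on `Nhat_j` and `H_j`, so Deligne's
condition is linear in `N_j`.

It remains to express the two conditions on relative weight filtrations. Condition (b) follows from
the other equations: `N_j` and `Nhat_j` act alike on the graded pieces of `W^{j-1}`, the weight of
`H_j` is the difference of those of `Y^j` and `Y^{j-1}`, and `sl₂`-theory gives the isomorphisms
(`IsSplitSl2.isRelativeWeightFiltration`). Condition (c) for `U = W^k_l` is replaced by the
requirement that `Y^{j-1}`, `Y^j` and `Nhat_j^+` preserve `U`. This suffices because all the
`sl₂`-data then restrict to `U`.

Necessity of that requirement is the main point (`IsSplitSl2.stable_of_restrict`): Deligne's grading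
is compatible with such subspaces. The graded space `L` of `U`, placed in `V` by means of `Y^{j-1}`,
is an `sl₂`-submodule by the isomorphisms on `U`. A lift `L → U` of the identity modulo lower
weights can be corrected degree by degree: its leading error, as an element of `Hom(L, V/L)`, has
positive `H_j`-weight and is killed by `ad Nhat_j^+ ∘ ad Nhat_j`, so it vanishes. Finally the
identity is a lift, so `U = L`. Descending induction on `j` yields the requirement for all `Y^j`. -/

namespace DeligneSys

open Polynomial

/-! ### Eigenprojectors of operators with bounded integral eigenvalues. -/

section Projectors

variable {K : Type*} [Field K] {V : Type*} [AddCommGroup V] [Module K V]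

/-- The integers of absolute value at most `B`. -/
noncomputable abbrev window (B : ℕ) : Finset ℤ := Finset.Icc (-(B : ℤ)) B

theorem window_nonempty (B : ℕ) : (window B).Nonempty := ⟨0, by simp⟩

/-- `Y` is annihilated by the product of the `Y - i` over the integers `i` with `|i| ≤ B`; in
characteristic zero this means that `Y` is diagonalizable with such integers as eigenvalues. -/
def IsBounded (B : ℕ) (Y : Module.End K V) : Prop :=
  aeval Y (Lagrange.nodal (window B) (fun i : ℤ => (i : K))) = 0

/-- The projector onto the eigenspace of `Y` for the eigenvalue `j`, as a Lagrange polynomial in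
`Y`. -/
noncomputable def proj (B : ℕ) (Y : Module.End K V) (j : ℤ) : Module.End K V :=
  if j ∈ window B then aeval Y (Lagrange.basis (window B) (fun i : ℤ => (i : K)) j) else 0

theorem commute_aeval {A Y : Module.End K V} (h : Commute A Y) (q : K[X]) :
    Commute A (aeval Y q) := by
  rw [aeval_eq_sum_range]
  exact Commute.sum_right _ _ _ fun i _ => (h.pow_right i).smul_right _

theorem commute_proj {B : ℕ} {Y A : Module.End K V} (h : Commute A Y) (j : ℤ) :
    Commute A (proj B Y j) := by
  unfold proj
  split_ifs
  · exact commute_aeval h _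
  · exact Commute.zero_right A

theorem commute_proj_apply {B : ℕ} {Y A : Module.End K V} (h : Commute A Y) (j : ℤ) (x : V) :
    A (proj B Y j x) = proj B Y j (A x) :=
  LinearMap.congr_fun (commute_proj h j) x

theorem proj_mem {B : ℕ} {Y : Module.End K V} {U : Submodule K V} (hU : ∀ x ∈ U, Y x ∈ U)
    (j : ℤ) {x : V} (hx : x ∈ U) : proj B Y j x ∈ U := by
  have hpow : ∀ n : ℕ, (Y ^ n) x ∈ U := by
    intro n
    induction n with
    | zero => simpa using hx
    | succ n ih => rw [pow_succ']; exact hU _ ih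
  unfold proj
  split_ifs
  · rw [aeval_eq_sum_range, LinearMap.sum_apply]
    exact U.sum_mem fun i _ => U.smul_mem _ (hpow i)
  · simp

theorem IsBounded.mono {B B' : ℕ} (h : B ≤ B') {Y : Module.End K V} (hY : IsBounded B Y) :
    IsBounded B' Y := by
  have : Lagrange.nodal (window B) (fun i : ℤ => (i : K)) ∣
      Lagrange.nodal (window B') (fun i : ℤ => (i : K)) := by
    simp only [Lagrange.nodal_eq]
    exact Finset.prod_dvd_prod_of_subset _ _ _ (Finset.Icc_subset_Icc (by omega) (by omega))
  obtain ⟨q, hq⟩ := this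
  unfold IsBounded at *
  rw [hq, map_mul, hY, zero_mul]

theorem isBounded_of_iSup {B : ℕ} {Y : Module.End K V}
    (h : ⨆ j : ℤ, Module.End.eigenspace Y (j : K) = ⊤)
    (h' : ∀ j : ℤ, ∀ x, Y x = (j : K) • x → j ∉ window B → x = 0) : IsBounded B Y := by
  unfold IsBounded
  rw [← LinearMap.ker_eq_top, eq_top_iff, ← h]
  refine iSup_le fun j x hx => ?_
  rw [Module.End.mem_eigenspace_iff] at hx
  rw [LinearMap.mem_ker, Module.End.aeval_apply_of_mem_apply_eq_smul hx]
  by_cases hj : j ∈ window B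
  · rw [Lagrange.eval_nodal_at_node hj, zero_smul]
  · rw [h' j x hx hj, smul_zero]

theorem proj_of_not_mem {B : ℕ} (Y : Module.End K V) {j : ℤ} (hj : j ∉ window B) :
    proj B Y j = 0 := if_neg hj

theorem IsGrading.mem_of_eigen {Y : Module.End K V} {W : ℤ → Submodule K V}
    (h : IsGrading Y W) {j k : ℤ} (hjk : j ≤ k) {x : V} (hx : Y x = (j : K) • x) : x ∈ W k := by
  rw [h.filtration_eq k]
  exact Submodule.mem_iSup_of_mem j (Submodule.mem_iSup_of_mem hjk
        (Module.End.mem_eigenspace_iff.mpr hx))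

theorem IsGrading.mono {Y : Module.End K V} {W : ℤ → Submodule K V}
    (h : IsGrading Y W) : Monotone W := by
  intro k l hkl
  rw [h.filtration_eq k, h.filtration_eq l]
  exact iSup_mono fun j => iSup_le fun hj => le_iSup_of_le (hj.trans hkl) le_rfl

theorem aeval_restrict_coe {Y : Module.End K V} {U : Submodule K V} (hU : ∀ x ∈ U, Y x ∈ U)
    (q : K[X]) (x : U) : ((aeval (Y.restrict hU) q x : U) : V) = aeval Y q (x : V) := by
  induction q using Polynomial.induction_on with
  | C a => simp
  | add p q hp hq => simp [hp, hq]
  | monomial n a h =>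
    simp only [map_mul, map_pow, aeval_C, aeval_X, Module.End.mul_apply,
      Module.algebraMap_end_apply, Submodule.coe_smul]
    congr 1
    clear h
    generalize n + 1 = m
    induction m generalizing x with
    | zero => simp
    | succ m ih => rw [pow_succ, pow_succ, Module.End.mul_apply, Module.End.mul_apply, ih]; rfl

theorem IsBounded.restrict {B : ℕ} {Y : Module.End K V} (hY : IsBounded B Y) {U : Submodule K V}
    (hU : ∀ x ∈ U, Y x ∈ U) : IsBounded B (Y.restrict hU) := by
  unfold IsBounded at *
  ext x
  rw [aeval_restrict_coe, hY]
  rfl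

theorem proj_restrict_coe {B : ℕ} {Y : Module.End K V} {U : Submodule K V}
    (hU : ∀ x ∈ U, Y x ∈ U) (j : ℤ) (x : U) :
    ((proj B (Y.restrict hU) j x : U) : V) = proj B Y j (x : V) := by
  unfold proj
  split_ifs
  · exact aeval_restrict_coe hU _ x
  · rfl

theorem apply_proj {B : ℕ} {Y : Module.End K V} (hY : IsBounded B Y) (j : ℤ) (x : V) :
    Y (proj B Y j x) = (j : K) • proj B Y j x := by
  by_cases hj : j ∈ window B
  · have h1 : (X - C (j : K)) * Lagrange.basis (window B) (fun i : ℤ => (i : K)) j =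
        C (Lagrange.nodalWeight (window B) (fun i : ℤ => (i : K)) j) *
          Lagrange.nodal (window B) (fun i : ℤ => (i : K)) := by
      rw [Lagrange.basis_eq_prod_sub_inv_mul_nodal_div hj, ← Lagrange.nodal_erase_eq_nodal_div hj,
        Lagrange.nodal_eq_mul_nodal_erase hj]
      ring
    have h2 := congrArg (fun q => aeval Y q x) h1
    simp only [map_mul, map_sub, aeval_X, aeval_C] at h2
    rw [show aeval Y (Lagrange.nodal (window B) (fun i : ℤ => (i : K))) = 0 from hY,
      mul_zero] at h2
    rw [proj, if_pos hj]
    rwa [LinearMap.zero_apply, Module.End.mul_apply, LinearMap.sub_apply,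
      Module.algebraMap_end_apply, sub_eq_zero] at h2
  · simp [proj, hj]

theorem IsGrading.map_mem {Y : Module.End K V} {W : ℤ → Submodule K V}
    (h : IsGrading Y W) {A : Module.End K V} (hA : Commute A Y) {k : ℤ} {x : V} (hx : x ∈ W k) :
    A x ∈ W k := by
  suffices W k ≤ (W k).comap A from this hx
  conv_lhs => rw [h.filtration_eq k]
  refine iSup_le fun j => iSup_le fun hj y hy => ?_
  rw [Module.End.mem_eigenspace_iff] at hy
  refine h.mem_of_eigen hj ?_
  have := LinearMap.congr_fun hA y
  simp only [Module.End.mul_apply] at this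
  rw [← this, hy, map_smul]

theorem IsGrading.proj_mem {B : ℕ} {Y : Module.End K V} {W : ℤ → Submodule K V}
    (h : IsGrading Y W) (hY : IsBounded B Y) {j k : ℤ} (hjk : j ≤ k) (x : V) :
    proj B Y j x ∈ W k :=
  h.mem_of_eigen hjk (apply_proj hY j x)

variable [CharZero K]

theorem injOn_window (B : ℕ) : Set.InjOn (fun i : ℤ => (i : K)) (window B) :=
  fun _ _ _ _ h => Int.cast_injective h

/-- A polynomial in `Y` acts on an eigenvector by its value at the eigenvalue. An eigenvalue outside
the window is not a root of the nodal polynomial, which forces `x = 0`; this makes the default value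
`0` of `proj` the correct one. -/
theorem proj_of_eigen {B : ℕ} {Y : Module.End K V} (hY : IsBounded B Y) {i : ℤ} {x : V}
    (hx : Y x = (i : K) • x) (j : ℤ) : proj B Y j x = if i = j then x else 0 := by
  have key : i ∉ window B → x = 0 := by
    intro hi
    have h1 : aeval Y (Lagrange.nodal (window B) (fun i : ℤ => (i : K))) x = 0 := by
      rw [hY]; rfl
    rw [Module.End.aeval_apply_of_mem_apply_eq_smul hx] at h1
    refine (smul_eq_zero.mp h1).resolve_left ?_
    apply Lagrange.eval_nodal_not_at_node
    intro k hk h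
    rw [Int.cast_injective h] at hi
    exact hi hk
  by_cases hj : j ∈ window B
  · rw [proj, if_pos hj, Module.End.aeval_apply_of_mem_apply_eq_smul hx]
    by_cases hi : i ∈ window B
    · split_ifs with h
      · subst h
        rw [Lagrange.eval_basis_self (injOn_window B) hj, one_smul]
      · rw [Lagrange.eval_basis_of_ne (v := fun i : ℤ => (i : K)) (s := window B)
          (i := j) (j := i) (fun e => h e.symm) hi, zero_smul]
    · rw [key hi]; simp
  · rw [proj, if_neg hj]
    split_ifs with h
    · rw [key (h ▸ hj)]; simp
    · rfl

theorem sum_proj (B : ℕ) (Y : Module.End K V) : ∑ j ∈ window B, proj B Y j = 1 := by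
  rw [← map_one (aeval (R := K) Y),
    ← Lagrange.sum_basis (injOn_window (K := K) B) (window_nonempty B), map_sum]
  exact Finset.sum_congr rfl fun j hj => if_pos hj

theorem sum_proj_apply (B : ℕ) (Y : Module.End K V) (x : V) :
    ∑ j ∈ window B, proj B Y j x = x := by
  have := congrArg (fun f => f x) (sum_proj B Y)
  simpa using this

theorem proj_proj {B : ℕ} {Y : Module.End K V} (hY : IsBounded B Y) (i j : ℤ) (x : V) :
    proj B Y j (proj B Y i x) = if i = j then proj B Y i x else 0 :=
  proj_of_eigen hY (apply_proj hY i x) j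

theorem eq_top_of_eigen {B : ℕ} {Y : Module.End K V} (hY : IsBounded B Y) {U : Submodule K V}
    (h : ∀ (i : ℤ) (x : V), Y x = (i : K) • x → x ∈ U) : ∀ x, x ∈ U := by
  intro x
  rw [← sum_proj_apply B Y x]
  exact U.sum_mem fun j _ => h j _ (apply_proj hY j x)

theorem hom_ext_eigen {V' : Type*} [AddCommGroup V'] [Module K V'] {B : ℕ} {Y : Module.End K V}
    (hY : IsBounded B Y) {f g : V →ₗ[K] V'}
    (h : ∀ (i : ℤ) (x : V), Y x = (i : K) • x → f x = g x) (x : V) : f x = g x :=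
  eq_top_of_eigen hY (U := LinearMap.eqLocus f g) h x

theorem proj_shift {B : ℕ} {Y A : Module.End K V} (hY : IsBounded B Y) {c : ℤ}
    (hA : ∀ x, Y (A x) = A (Y x) + (c : K) • A x) (j : ℤ) (x : V) :
    proj B Y (j + c) (A x) = A (proj B Y j x) := by
  refine hom_ext_eigen hY (f := proj B Y (j + c) ∘ₗ A) (g := A ∘ₗ proj B Y j)
    (fun i x hx => ?_) x
  have h1 : Y (A x) = ((i + c : ℤ) : K) • A x := by
    rw [hA, hx, map_smul, ← add_smul]; push_cast; rfl
  simp only [LinearMap.comp_apply]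
  rw [proj_of_eigen hY h1, proj_of_eigen hY hx]
  by_cases h : i = j
  · simp [h]
  · simp [h]

theorem IsBounded.iSup_eigenspace {B : ℕ} {Y : Module.End K V} (hY : IsBounded B Y) :
    ⨆ j : ℤ, Module.End.eigenspace Y (j : K) = ⊤ := by
  rw [eq_top_iff]
  intro x _
  refine eq_top_of_eigen hY (fun i x hx => ?_) x
  exact Submodule.mem_iSup_of_mem i (Module.End.mem_eigenspace_iff.mpr hx)

theorem mem_iSup_eigenspace_iff {B : ℕ} {Y : Module.End K V} (hY : IsBounded B Y) (k : ℤ) (x : V) :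
    x ∈ (⨆ j : ℤ, ⨆ _ : j ≤ k, Module.End.eigenspace Y (j : K)) ↔
      ∀ j, k < j → proj B Y j x = 0 := by
  constructor
  · intro hx j hj
    suffices (⨆ j : ℤ, ⨆ _ : j ≤ k, Module.End.eigenspace Y (j : K)) ≤
      LinearMap.ker (proj B Y j) from this hx
    refine iSup_le fun i => iSup_le fun hi y hy => ?_
    rw [LinearMap.mem_ker, proj_of_eigen hY (Module.End.mem_eigenspace_iff.mp hy), if_neg]
    omega
  · intro h
    rw [← sum_proj_apply B Y x]
    refine Submodule.sum_mem _ fun j _ => ?_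
    by_cases hj : j ≤ k
    · exact Submodule.mem_iSup_of_mem j (Submodule.mem_iSup_of_mem hj
        (Module.End.mem_eigenspace_iff.mpr (apply_proj hY j x)))
    · rw [h j (by omega)]; exact Submodule.zero_mem _

theorem IsGrading.mem_iff {B : ℕ} {Y : Module.End K V} {W : ℤ → Submodule K V}
    (h : IsGrading Y W) (hY : IsBounded B Y) {k : ℤ} {x : V} :
    x ∈ W k ↔ ∀ j, k < j → proj B Y j x = 0 := by
  rw [h.filtration_eq k, mem_iSup_eigenspace_iff hY]

theorem isGrading_of_mem_iff {B : ℕ} {Y : Module.End K V} {W : ℤ → Submodule K V}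
    (hY : IsBounded B Y) (h : ∀ k x, x ∈ W k ↔ ∀ j, k < j → proj B Y j x = 0) :
    IsGrading Y W := by
  refine ⟨hY.iSup_eigenspace, fun k => ?_⟩
  ext x
  rw [h, mem_iSup_eigenspace_iff hY]

theorem IsGrading.isFiltration {B : ℕ} {Y : Module.End K V} {W : ℤ → Submodule K V}
    (h : IsGrading Y W) (hY : IsBounded B Y) : IsFiltration W where
  mono := h.mono
  separated := by
    refine ⟨-(B : ℤ) - 1, (Submodule.eq_bot_iff _).mpr fun x hx => ?_⟩
    rw [h.mem_iff hY] at hx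
    rw [← sum_proj_apply B Y x]
    refine Finset.sum_eq_zero fun j hj => hx j ?_
    rw [Finset.mem_Icc] at hj; omega
  exhaustive := by
    refine ⟨B, Submodule.eq_top_iff'.mpr fun x => ?_⟩
    rw [h.mem_iff hY]
    intro j hj
    rw [proj_of_not_mem, LinearMap.zero_apply]
    rw [Finset.mem_Icc]; omega

/-- The part of `x ∈ W k` of lower weight. -/
theorem IsGrading.sub_proj_mem {B : ℕ} {Y : Module.End K V} {W : ℤ → Submodule K V}
    (h : IsGrading Y W) (hY : IsBounded B Y) {k : ℤ} {x : V} (hx : x ∈ W k) :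
    x - proj B Y k x ∈ W (k - 1) := by
  rw [h.mem_iff hY] at hx ⊢
  intro j hj
  rw [map_sub, proj_proj hY]
  split_ifs with e
  · rw [e, sub_self]
  · rw [hx j (by omega), sub_zero]

/-- An operator maps `W k` to `W (k + c)` for all `k` if and only if its components of degree
larger than `c` vanish. -/
theorem IsGrading.map_mem_iff {B : ℕ} {Y : Module.End K V} {W : ℤ → Submodule K V}
    (h : IsGrading Y W) (hY : IsBounded B Y) (A : Module.End K V) (c : ℤ) :
    (∀ k, ∀ x ∈ W k, A x ∈ W (k + c)) ↔
      ∀ a b, b + c < a → proj B Y a * A * proj B Y b = 0 := by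
  constructor
  · intro H a b hab
    ext x
    have := H b _ (h.proj_mem hY le_rfl x)
    rw [h.mem_iff hY] at this
    simpa using this a hab
  · intro H k x hx
    rw [h.mem_iff hY] at hx ⊢
    intro a ha
    conv_lhs => rw [← sum_proj_apply B Y x]
    rw [map_sum, map_sum]
    refine Finset.sum_eq_zero fun b _ => ?_
    by_cases hb : k < b
    · rw [hx b hb]; simp
    · exact LinearMap.congr_fun (H a b (by omega)) x

theorem exists_isBounded [FiniteDimensional K V] {Y : Module.End K V}
    (h : ⨆ j : ℤ, Module.End.eigenspace Y (j : K) = ⊤) : ∃ B, IsBounded B Y := by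
  have hfin : Set.Finite {j : ℤ | Module.End.HasEigenvalue Y (j : K)} :=
    Set.Finite.preimage (Int.cast_injective.injOn) (Module.End.finite_hasEigenvalue Y)
  obtain ⟨B, hB⟩ := (hfin.image Int.natAbs).bddAbove
  refine ⟨B, isBounded_of_iSup h fun j x hx hj => ?_⟩
  by_contra h0
  have : j.natAbs ≤ B := hB ⟨j, Module.End.hasEigenvalue_of_hasEigenvector
    ⟨Module.End.mem_eigenspace_iff.mpr hx, h0⟩, rfl⟩
  apply hj
  rw [Finset.mem_Icc]; omega

/-- Eigenvalues of a grading are jumps of the filtration, so the bound depends on `W` only and is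
uniform over all gradings of `W`. -/
theorem IsGrading.isBounded_of_filtration [FiniteDimensional K V] {W : ℤ → Submodule K V}
    {Y : Module.End K V} (h : IsGrading Y W) {B : ℕ}
    (h₁ : W (-(B : ℤ) - 1) = ⊥) (h₂ : W B = ⊤) : IsBounded B Y := by
  obtain ⟨B', hB'⟩ := exists_isBounded h.diagonalizable
  refine isBounded_of_iSup h.diagonalizable fun j x hx hj => ?_
  rw [Finset.mem_Icc, not_and_or] at hj
  rcases hj with hj | hj
  · have : x ∈ W (-(B : ℤ) - 1) := h.mem_of_eigen (by omega) hx
    rw [h₁] at this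
    exact (Submodule.mem_bot K).mp this
  · have : x ∈ W B := by rw [h₂]; trivial
    rw [h.mem_iff hB'] at this
    have := this j (by omega)
    rwa [proj_of_eigen hB' hx, if_pos rfl] at this

/-- The coefficient `e` is `0` or `±1`, so that sums and differences of commuting operators are
treated at once, on joint eigenvectors. -/
theorem isBounded_zsmul_add {B B' : ℕ} {Y Y' : Module.End K V} (hY : IsBounded B Y)
    (hY' : IsBounded B' Y') (hc : Commute Y Y') (e : ℤ) (he : e.natAbs ≤ 1) :
    IsBounded (B + B') (Y + (e : K) • Y') := by
  unfold IsBounded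
  ext x
  rw [← sum_proj_apply B Y x, map_sum, LinearMap.zero_apply]
  refine Finset.sum_eq_zero fun a ha => ?_
  rw [← sum_proj_apply B' Y' (proj B Y a x), map_sum]
  refine Finset.sum_eq_zero fun b hb => ?_
  have h1 : (Y + (e : K) • Y') (proj B' Y' b (proj B Y a x)) =
      ((a + e * b : ℤ) : K) • (proj B' Y' b (proj B Y a x)) := by
    rw [LinearMap.add_apply, LinearMap.smul_apply, apply_proj hY', commute_proj_apply hc,
      apply_proj hY, map_smul, smul_smul, ← add_smul]
    push_cast; rfl
  rw [Module.End.aeval_apply_of_mem_apply_eq_smul h1]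
  have : a + e * b ∈ window (B + B') := by
    rw [Finset.mem_Icc] at ha hb ⊢
    have : e = 0 ∨ e = 1 ∨ e = -1 := by omega
    rcases this with rfl | rfl | rfl <;> omega
  rw [Lagrange.eval_nodal_at_node this, zero_smul]

theorem IsBounded.add {B B' : ℕ} {Y Y' : Module.End K V} (hY : IsBounded B Y)
    (hY' : IsBounded B' Y') (hc : Commute Y Y') : IsBounded (B + B') (Y + Y') := by
  simpa using isBounded_zsmul_add hY hY' hc 1 (by simp)

theorem IsBounded.sub {B B' : ℕ} {Y Y' : Module.End K V} (hY : IsBounded B Y)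
    (hY' : IsBounded B' Y') (hc : Commute Y Y') : IsBounded (B + B') (Y - Y') := by
  simpa [sub_eq_add_neg] using isBounded_zsmul_add hY hY' hc (-1) (by simp)

theorem IsGrading.restrict {B : ℕ} {Y : Module.End K V} {W : ℤ → Submodule K V}
    (h : IsGrading Y W) (hY : IsBounded B Y) {U : Submodule K V} (hU : ∀ x ∈ U, Y x ∈ U) :
    IsGrading (Y.restrict hU) (restrictFiltration W U) := by
  refine isGrading_of_mem_iff (hY.restrict hU) fun k x => ?_
  rw [restrictFiltration, Submodule.submoduleOf, Submodule.mem_comap, Submodule.subtype_apply,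
    h.mem_iff hY]
  refine forall_congr' fun j => imp_congr_right fun _ => ?_
  rw [← proj_restrict_coe hU, Submodule.coe_eq_zero]

/-- A component of degree `n` moves the eigenvalue `b` to `b + n`, so cutting with the same
projector on both sides keeps only `n = 0`. The resulting formula is polynomial in `Y` and `N`. -/
theorem IsZeroComponent.eq_sum {B : ℕ} {Y N N₀ : Module.End K V} (hY : IsBounded B Y)
    (h : IsZeroComponent Y N N₀) : N₀ = ∑ b ∈ window B, proj B Y b * N * proj B Y b := by
  obtain ⟨c, hc, hN, h0⟩ := h
  have hsh : ∀ n x, Y (c n x) = c n (Y x) + (n : K) • c n x := by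
    intro n x
    have := LinearMap.congr_fun (hc n) x
    simp only [Ring.lie_def, LinearMap.sub_apply, Module.End.mul_apply,
      LinearMap.smul_apply] at this
    rw [← this]; abel
  have key : ∀ b x, proj B Y b (N (proj B Y b x)) = N₀ (proj B Y b x) := by
    intro b x
    rw [← hN, Finsupp.sum, LinearMap.sum_apply, map_sum]
    have : ∀ n, proj B Y b (c n (proj B Y b x)) = if n = 0 then N₀ (proj B Y b x) else 0 := by
      intro n
      have := proj_shift hY (hsh n) (b - n) (proj B Y b x)
      rw [sub_add_cancel, proj_proj hY] at this
      rw [this]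
      by_cases hn : n = 0
      · simp [hn, h0]
      · rw [if_neg (by omega), if_neg hn, map_zero]
    simp only [this]
    rw [Finset.sum_ite_eq']
    split_ifs with hm
    · rfl
    · rw [Finsupp.notMem_support_iff] at hm
      rw [← h0, hm, LinearMap.zero_apply]
  ext x
  conv_lhs => rw [← sum_proj_apply B Y x]
  rw [map_sum, LinearMap.sum_apply]
  exact Finset.sum_congr rfl fun b _ => (key b x).symm

theorem isZeroComponent_sum {B : ℕ} {Y : Module.End K V} (hY : IsBounded B Y)
    (N : Module.End K V) :
    IsZeroComponent Y N (∑ b ∈ window B, proj B Y b * N * proj B Y b) := by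
  -- The component of degree `n`. Both `b` and `b + n` lie in the window only if `|n| ≤ 2B`, whence
  -- the finite support.
  let c : ℤ → Module.End K V := fun n => ∑ b ∈ window B, proj B Y (b + n) * N * proj B Y b
  have hc0 : ∀ n, c n ≠ 0 → n ∈ window (B + B) := by
    intro n hn
    obtain ⟨b, hb, hb'⟩ := Finset.exists_ne_zero_of_sum_ne_zero hn
    by_contra hn'
    apply hb'
    rw [proj_of_not_mem Y (j := b + n), zero_mul, zero_mul]
    rw [Finset.mem_Icc] at *
    omega
  refine ⟨Finsupp.onFinset (window (B + B)) c hc0, fun n => ?_, ?_, ?_⟩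
  · rw [Finsupp.onFinset_apply]
    refine LinearMap.ext fun x => ?_
    rw [Ring.lie_def]
    simp only [c, LinearMap.sub_apply, Module.End.mul_apply, LinearMap.sum_apply, map_sum,
      LinearMap.smul_apply, Finset.smul_sum, ← Finset.sum_sub_distrib]
    refine Finset.sum_congr rfl fun b _ => ?_
    rw [apply_proj hY, ← commute_proj_apply (Commute.refl Y), apply_proj hY, map_smul, map_smul,
      ← sub_smul]
    push_cast
    rw [add_sub_cancel_left]
  · rw [Finsupp.onFinset_sum _ fun _ => rfl]
    have h1 : ∀ b ∈ window B, ∑ n ∈ window (B + B), proj B Y (b + n) = 1 := by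
      intro b hb
      rw [← sum_proj B Y]
      symm
      refine Finset.sum_of_injOn (fun a => a - b) (fun a _ a' _ h => by simpa using h) ?_ ?_ ?_
      · intro a ha
        simp only [Finset.coe_Icc, Set.mem_Icc, Finset.mem_Icc] at *
        push_cast
        omega
      · intro n _ hn
        refine proj_of_not_mem Y fun hm => hn ⟨b + n, by exact_mod_cast hm, by simp⟩
      · intro a _; congr 1; ring
    simp only [c]
    rw [Finset.sum_comm]
    calc ∑ b ∈ window B, ∑ n ∈ window (B + B), proj B Y (b + n) * N * proj B Y b
        = ∑ b ∈ window B, N * proj B Y b := Finset.sum_congr rfl fun b hb => by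
          rw [← Finset.sum_mul, ← Finset.sum_mul, h1 b hb, one_mul]
      _ = N := by rw [← Finset.mul_sum, sum_proj, mul_one]
  · simp [c]

end Projectors
end DeligneSys

namespace DeligneSys

/-! ### Weight vectors in finite-dimensional representations of `sl₂`. -/

section Sl2

variable {K : Type*} [Field K] {T : Type*} [AddCommGroup T] [Module K T]
  {F H E : Module.End K T}

namespace IsSl2Rep

theorem pos_neg (h : IsSl2Rep F H E) (x : T) : E (F x) = F (E x) + H x := by
  have := LinearMap.congr_fun h.lie_pos_neg x
  simp only [Ring.lie_def, LinearMap.sub_apply, Module.End.mul_apply] at this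
  rw [← this]; abel

theorem weight_neg (h : IsSl2Rep F H E) {c : K} {x : T} (hx : H x = c • x) :
    H (F x) = (c - 2) • F x := by
  have := LinearMap.congr_fun h.lie_cartan_neg x
  simp only [Ring.lie_def, LinearMap.sub_apply, Module.End.mul_apply, LinearMap.smul_apply, hx,
    map_smul] at this
  rw [sub_eq_iff_eq_add] at this
  rw [this]; module

theorem weight_pos (h : IsSl2Rep F H E) {c : K} {x : T} (hx : H x = c • x) :
    H (E x) = (c + 2) • E x := by
  have := LinearMap.congr_fun h.lie_cartan_pos x
  simp only [Ring.lie_def, LinearMap.sub_apply, Module.End.mul_apply, LinearMap.smul_apply, hx,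
    map_smul] at this
  rw [sub_eq_iff_eq_add] at this
  rw [this]; module

theorem swap (h : IsSl2Rep F H E) : IsSl2Rep E (-H) F where
  lie_pos_neg := by
    rw [← h.lie_pos_neg, Ring.lie_def, Ring.lie_def]; abel
  lie_cartan_pos := by
    have := h.lie_cartan_neg
    rw [Ring.lie_def] at this ⊢
    rw [neg_mul, mul_neg, sub_neg_eq_add, neg_add_eq_sub, ← neg_sub, this, neg_smul, neg_neg]
  lie_cartan_neg := by
    have := h.lie_cartan_pos
    rw [Ring.lie_def] at this ⊢
    rw [neg_mul, mul_neg, sub_neg_eq_add, neg_add_eq_sub, ← neg_sub, this, neg_smul]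

theorem weight_neg_pow (h : IsSl2Rep F H E) {c : K} {x : T} (hx : H x = c • x) (n : ℕ) :
    H ((F ^ n) x) = (c - 2 * n) • (F ^ n) x := by
  induction n with
  | zero => simpa using hx
  | succ n ih =>
    rw [pow_succ', Module.End.mul_apply, h.weight_neg ih]
    push_cast
    module

theorem pos_neg_pow (h : IsSl2Rep F H E) {c : K} {x : T} (hx : H x = c • x) (n : ℕ) :
    E ((F ^ (n + 1)) x) = (F ^ (n + 1)) (E x) + ((n + 1) * (c - n)) • (F ^ n) x := by
  induction n with
  | zero => simp [h.pos_neg, hx]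
  | succ n ih =>
    rw [pow_succ', Module.End.mul_apply, h.pos_neg, ih, h.weight_neg_pow hx, map_add, map_smul,
      ← Module.End.mul_apply F (F ^ (n + 1)), ← pow_succ', ← Module.End.mul_apply F (F ^ n),
      ← pow_succ']
    push_cast
    module

theorem restrict (h : IsSl2Rep F H E) {U : Submodule K T} (hF : ∀ x ∈ U, F x ∈ U)
    (hH : ∀ x ∈ U, H x ∈ U) (hE : ∀ x ∈ U, E x ∈ U) :
    IsSl2Rep (F.restrict hF) (H.restrict hH) (E.restrict hE) where
  lie_pos_neg := by
    ext x; exact LinearMap.congr_fun h.lie_pos_neg x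
  lie_cartan_pos := by
    ext x; exact LinearMap.congr_fun h.lie_cartan_pos x
  lie_cartan_neg := by
    ext x; exact LinearMap.congr_fun h.lie_cartan_neg x

variable [CharZero K] [FiniteDimensional K T]

theorem exists_weight_bound (H : Module.End K T) :
    ∃ M : ℕ, ∀ m : ℕ, M < m → ∀ x, H x = (m : K) • x → x = 0 := by
  have hfin : Set.Finite {m : ℕ | Module.End.HasEigenvalue H (m : K)} :=
    Set.Finite.preimage (Nat.cast_injective.injOn) (Module.End.finite_hasEigenvalue H)
  obtain ⟨M, hM⟩ := hfin.bddAbove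
  refine ⟨M, fun m hm x hx => ?_⟩
  by_contra h0
  have : m ≤ M := hM (Module.End.hasEigenvalue_of_hasEigenvector
    ⟨Module.End.mem_eigenspace_iff.mpr hx, h0⟩)
  omega

/-- Both claims are proved together by descending induction on the weight, without complete
reducibility. If `F ^ (m + 1)` kills `x`, the commutation formula shows that `F ^ (m + 2)` kills `E
x`, of weight `m + 2`, so `E x = 0`. Then `E F^(i+1) x` is a nonzero multiple of `F^i x` for `i <
m`, and `F^m x = 0` descends to `x = 0`. -/
theorem injective_aux (h : IsSl2Rep F H E) (m : ℕ) :
    (∀ x, H x = (m : K) • x → (F ^ m) x = 0 → x = 0) ∧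
      (∀ x, H x = (m : K) • x → (F ^ (m + 1)) x = 0 → E x = 0) := by
  obtain ⟨M, hM⟩ := exists_weight_bound H
  -- The number `d` measures how far `m` may lie below the largest weight; at `d = 0` the weight
  -- space is zero.
  suffices ∀ d m : ℕ, M < m + d → (∀ x, H x = (m : K) • x → (F ^ m) x = 0 → x = 0) ∧
      (∀ x, H x = (m : K) • x → (F ^ (m + 1)) x = 0 → E x = 0) from this (M + 1) m (by omega)
  intro d
  induction d with
  | zero =>
    intro m hm
    refine ⟨fun x hx _ => hM m hm x hx, fun x hx _ => ?_⟩
    rw [hM m hm x hx, map_zero]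
  | succ d ih =>
    intro m hm
    have hE : ∀ x, H x = (m : K) • x → (F ^ (m + 1)) x = 0 → E x = 0 := by
      intro x hx hF
      refine (ih (m + 2) (by omega)).1 _ (by rw [h.weight_pos hx]; push_cast; rfl) ?_
      have := h.pos_neg_pow hx (m + 1)
      rw [hF, smul_zero, add_zero] at this
      rw [← this, pow_succ', Module.End.mul_apply, hF, map_zero, map_zero]
    refine ⟨fun x hx hF => ?_, hE⟩
    have hEx : E x = 0 := hE x hx (by rw [pow_succ', Module.End.mul_apply, hF, map_zero])
    have key : ∀ i ≤ m, (F ^ i) x = 0 → x = 0 := by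
      intro i
      induction i with
      | zero => intro _ h0; simpa using h0
      | succ i ih =>
        intro hi h0
        have := h.pos_neg_pow hx i
        rw [h0, hEx, map_zero, map_zero, zero_add] at this
        refine ih (by omega) ((smul_eq_zero.mp this.symm).resolve_left ?_)
        refine mul_ne_zero (by exact_mod_cast i.succ_ne_zero) (sub_ne_zero.mpr ?_)
        exact_mod_cast (show m ≠ i by omega)
    exact key m le_rfl hF

theorem injective (h : IsSl2Rep F H E) {m : ℕ} {x : T} (hx : H x = (m : K) • x)
    (hF : (F ^ m) x = 0) : x = 0 :=
  (h.injective_aux m).1 x hx hF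

theorem primitive (h : IsSl2Rep F H E) {m : ℕ} {x : T} (hx : H x = (m : K) • x)
    (hF : (F ^ (m + 1)) x = 0) : E x = 0 :=
  (h.injective_aux m).2 x hx hF

/-- `F ^ m` and, by symmetry, `E ^ m` are injective between the spaces of weight `m` and `-m`, so
the dimensions agree. -/
theorem surjective (h : IsSl2Rep F H E) {m : ℕ} {y : T} (hy : H y = (-m : K) • y) :
    ∃ x, H x = (m : K) • x ∧ (F ^ m) x = y := by
  let P := Module.End.eigenspace H (m : K)
  let Q := Module.End.eigenspace H (-m : K)
  have hF : ∀ x ∈ P, (F ^ m) x ∈ Q := by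
    intro x hx
    rw [Module.End.mem_eigenspace_iff] at hx ⊢
    rw [h.weight_neg_pow hx]
    congr 1; ring
  have hE : ∀ x ∈ Q, (E ^ m) x ∈ P := by
    intro x hx
    rw [Module.End.mem_eigenspace_iff] at hx ⊢
    have := h.swap.weight_neg_pow (c := (m : K)) (x := x) (by simp [hx]) m
    rw [LinearMap.neg_apply, neg_eq_iff_eq_neg] at this
    rw [this]; module
  let f : P →ₗ[K] Q := (F ^ m).restrict hF
  let g : Q →ₗ[K] P := (E ^ m).restrict hE
  have hf : Function.Injective f := by
    rw [← LinearMap.ker_eq_bot, LinearMap.ker_eq_bot']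
    intro x hx
    exact Subtype.ext (h.injective (Module.End.mem_eigenspace_iff.mp x.2)
      (congrArg Subtype.val hx))
  have hg : Function.Injective g := by
    rw [← LinearMap.ker_eq_bot, LinearMap.ker_eq_bot']
    intro x hx
    have h2 := Module.End.mem_eigenspace_iff.mp x.2
    exact Subtype.ext (h.swap.injective (m := m) (by simp [h2])
      (congrArg Subtype.val hx))
  have hdim : Module.finrank K P = Module.finrank K Q :=
    le_antisymm (LinearMap.finrank_le_finrank_of_injective hf)
      (LinearMap.finrank_le_finrank_of_injective hg)
  obtain ⟨x, hx⟩ := (LinearMap.injective_iff_surjective_of_finrank_eq_finrank hdim).mp hf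
    ⟨y, Module.End.mem_eigenspace_iff.mpr hy⟩
  exact ⟨x, Module.End.mem_eigenspace_iff.mp x.2, congrArg Subtype.val hx⟩

/-- A vector of positive weight whose image under `F` is annihilated by `E` vanishes. -/
theorem eq_zero_of_pos (h : IsSl2Rep F H E) {k : ℕ} {x : T} (hx : H x = ((k + 1 : ℕ) : K) • x)
    (hEF : E (F x) = 0) : x = 0 := by
  have hz : H (F x) = ((k : K) - 1) • F x := by
    rw [h.weight_neg hx]; congr 1; push_cast; ring
  -- `F x` is primitive of weight `k - 1`, so the coefficient `k (k - 1 - (k - 1))` in the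
  -- commutation formula vanishes. Thus `F^k (F x)` is killed by `E` in the negative weight `-(k +
  -- 1)`, where `E ^ (k + 1)` is injective.
  have h1 : E ((F ^ k) (F x)) = 0 := by
    rcases k with _ | k
    · simpa using hEF
    · rw [h.pos_neg_pow hz, hEF, map_zero, zero_add]
      push_cast
      simp
  have h2 : H ((F ^ k) (F x)) = -((k + 1 : ℕ) : K) • (F ^ k) (F x) := by
    rw [h.weight_neg_pow hz]; congr 1; push_cast; ring
  have h3 : (F ^ k) (F x) = 0 := by
    refine h.swap.injective (m := k + 1) (by rw [LinearMap.neg_apply, h2]; module) ?_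
    rw [pow_succ, Module.End.mul_apply, h1, map_zero]
  refine h.injective hx ?_
  rwa [pow_succ, Module.End.mul_apply]

end IsSl2Rep
end Sl2
end DeligneSys

namespace DeligneSys

/-! ### Relative weight filtrations from commuting gradings and an `sl₂`-triple. -/

section RelativeWeight

variable {K : Type*} [Field K] {V : Type*} [AddCommGroup V] [Module K V]

theorem inducesIso_iff {f : Module.End K V} {A A' B B' : Submodule K V} :
    InducesIso f A A' B B' ↔
      (∀ x ∈ A, f x ∈ B) ∧ (∀ x ∈ A, x ∈ A' → f x ∈ B') ∧ (∀ x ∈ A, f x ∈ B' → x ∈ A') ∧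
        ∀ y ∈ B, ∃ x ∈ A, y - f x ∈ B' := by
  constructor
  · rintro ⟨h, h', hinj, hsurj⟩
    refine ⟨h, fun x hx hx' => @h' ⟨x, hx⟩ hx', fun x hx hfx => ?_, fun y hy => ?_⟩
    · have : (A'.submoduleOf A).mkQ ⟨x, hx⟩ = 0 := by
        apply hinj
        rw [map_zero]
        exact (Submodule.Quotient.mk_eq_zero (B'.submoduleOf B)).mpr hfx
      exact (Submodule.Quotient.mk_eq_zero (A'.submoduleOf A)).mp this
    · obtain ⟨q, hq⟩ := hsurj ((B'.submoduleOf B).mkQ ⟨y, hy⟩)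
      obtain ⟨⟨x, hx⟩, rfl⟩ := (A'.submoduleOf A).mkQ_surjective q
      exact ⟨x, hx, (Submodule.Quotient.eq (B'.submoduleOf B)).mp hq.symm⟩
  · rintro ⟨h, h', hinj, hsurj⟩
    refine ⟨h, fun x hx => h' x.1 x.2 hx, ?_, ?_⟩
    · rw [← LinearMap.ker_eq_bot, LinearMap.ker_eq_bot']
      intro q hq
      obtain ⟨⟨x, hx⟩, rfl⟩ := (A'.submoduleOf A).mkQ_surjective q
      exact (Submodule.Quotient.mk_eq_zero (A'.submoduleOf A)).mpr
        (hinj x hx ((Submodule.Quotient.mk_eq_zero (B'.submoduleOf B)).mp hq))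
    · intro q
      obtain ⟨⟨y, hy⟩, rfl⟩ := (B'.submoduleOf B).mkQ_surjective q
      obtain ⟨x, hx, hxy⟩ := hsurj y hy
      exact ⟨(A'.submoduleOf A).mkQ ⟨x, hx⟩,
        ((Submodule.Quotient.eq (B'.submoduleOf B)).mpr hxy).symm⟩

theorem pow_mem {f : Module.End K V} {U : Submodule K V} (h : ∀ x ∈ U, f x ∈ U) (n : ℕ) :
    ∀ x ∈ U, (f ^ n) x ∈ U := by
  intro x hx
  induction n with
  | zero => exact hx
  | succ n ih => rw [pow_succ']; exact h _ ih

/-- `Y'` and `Y` are commuting gradings of `W` and `M`, and the operator `N`, which preserves `W`,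
has the same action on `Gr^W` as an operator `N₀` of degree zero for `Y'`, which is part of an
`sl₂`-triple `(N₀, Y - Y', E)`. -/
structure IsSplitSl2 (B : ℕ) (W M : ℤ → Submodule K V) (N N₀ E Y' Y : Module.End K V) :
    Prop where
  gradW : IsGrading Y' W
  gradM : IsGrading Y M
  bddW : IsBounded B Y'
  bddM : IsBounded B Y
  comm : Commute Y' Y
  comm₀ : Commute N₀ Y'
  sl2 : IsSl2Rep N₀ (Y - Y') E
  stable : ∀ k, ∀ x ∈ W k, N x ∈ W k
  lead : ∀ k, ∀ x ∈ W k, N x - N₀ x ∈ W (k - 1)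

namespace IsSplitSl2

variable [CharZero K] {B : ℕ} {W M : ℤ → Submodule K V} {N N₀ E Y' Y : Module.End K V}

theorem proj_apply (h : IsSplitSl2 B W M N N₀ E Y' Y) {k : ℤ} {x : V} (hx : x ∈ W k) :
    proj B Y' k (N x) = N₀ (proj B Y' k x) := by
  have := (h.gradW.mem_iff h.bddW).mp (h.lead k x hx) k (by omega)
  rw [map_sub, sub_eq_zero] at this
  rw [this, commute_proj_apply h.comm₀]

theorem proj_pow_apply (h : IsSplitSl2 B W M N N₀ E Y' Y) {k : ℤ} {x : V} (hx : x ∈ W k)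
    (l : ℕ) : proj B Y' k ((N ^ l) x) = (N₀ ^ l) (proj B Y' k x) := by
  induction l with
  | zero => rfl
  | succ l ih =>
    rw [pow_succ', pow_succ', Module.End.mul_apply, Module.End.mul_apply,
      h.proj_apply (pow_mem (h.stable k) l x hx), ih]

omit [CharZero K] in
theorem commute_proj_proj (h : IsSplitSl2 B W M N N₀ E Y' Y) (a k : ℤ) (x : V) :
    proj B Y a (proj B Y' k x) = proj B Y' k (proj B Y a x) :=
  commute_proj_apply (commute_proj h.comm a).symm k x

omit [CharZero K] in
theorem shift (h : IsSplitSl2 B W M N N₀ E Y' Y) (x : V) :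
    Y (N₀ x) = N₀ (Y x) + ((-2 : ℤ) : K) • N₀ x := by
  have h1 := LinearMap.congr_fun h.sl2.lie_cartan_neg x
  have h2 := LinearMap.congr_fun h.comm₀ x
  simp only [Ring.lie_def, LinearMap.sub_apply, Module.End.mul_apply, LinearMap.smul_apply,
    map_sub] at h1 h2
  rw [h2] at h1
  push_cast
  rw [← h1]
  abel

theorem proj_pow_shift (h : IsSplitSl2 B W M N N₀ E Y' Y) (j : ℤ) (l : ℕ) (x : V) :
    proj B Y (j - 2 * l) ((N₀ ^ l) x) = (N₀ ^ l) (proj B Y j x) := by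
  induction l with
  | zero => simp
  | succ l ih =>
    rw [pow_succ', Module.End.mul_apply, Module.End.mul_apply, ← ih,
      ← proj_shift h.bddM h.shift]
    congr 2
    push_cast; ring

omit [CharZero K] in
theorem proj_mem_W (h : IsSplitSl2 B W M N N₀ E Y' Y) (a : ℤ) {k : ℤ} {x : V} (hx : x ∈ W k) :
    proj B Y a x ∈ W k :=
  h.gradW.map_mem (commute_proj h.comm a).symm hx

theorem mem_grStep (h : IsSplitSl2 B W M N N₀ E Y' Y) {m k : ℤ} {x : V} :
    x ∈ grStep M W m k ↔
      x ∈ W k ∧ ∀ a, m < a → proj B Y a (proj B Y' k x) = 0 := by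
  constructor
  · intro hx
    obtain ⟨u, ⟨huM, huW⟩, w, hw, rfl⟩ := Submodule.mem_sup.mp hx
    refine ⟨(W k).add_mem huW (h.gradW.mono (by omega) hw), fun a ha => ?_⟩
    rw [map_add, (h.gradW.mem_iff h.bddW).mp hw k (by omega), add_zero, h.commute_proj_proj,
      (h.gradM.mem_iff h.bddM).mp huM a ha, map_zero]
  · rintro ⟨hxW, hx⟩
    rw [← add_sub_cancel (proj B Y' k x) x]
    exact Submodule.add_mem_sup
      ⟨(h.gradM.mem_iff h.bddM).mpr hx, h.gradW.proj_mem h.bddW le_rfl x⟩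
      (h.gradW.sub_proj_mem h.bddW hxW)

omit [CharZero K] in
/-- A vector in the joint eigenspaces of `Y` and `Y'`. -/
theorem weight (h : IsSplitSl2 B W M N N₀ E Y' Y) (a k : ℤ) (x : V) :
    (Y - Y') (proj B Y a (proj B Y' k x)) = ((a - k : ℤ) : K) • proj B Y a (proj B Y' k x) := by
  rw [LinearMap.sub_apply, apply_proj h.bddM, h.commute_proj_proj, apply_proj h.bddW]
  push_cast
  rw [sub_smul]

omit [CharZero K] in
theorem pow_mem_grStep (h : IsSplitSl2 B W M N N₀ E Y' Y)
    (hM : ∀ k, ∀ x ∈ M k, N x ∈ M (k - 2)) (l : ℕ) {m k : ℤ} {x : V}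
    (hx : x ∈ grStep M W m k) : (N ^ l) x ∈ grStep M W (m - 2 * l) k := by
  have hMl : ∀ x ∈ M m, (N ^ l) x ∈ M (m - 2 * l) := by
    intro x hx
    clear * - hx hM
    induction l with
    | zero => simpa using hx
    | succ l ih =>
      rw [pow_succ', Module.End.mul_apply]
      convert hM _ _ ih using 2
      push_cast; ring
  obtain ⟨u, ⟨huM, huW⟩, w, hw, rfl⟩ := Submodule.mem_sup.mp hx
  rw [map_add]
  exact Submodule.add_mem_sup ⟨hMl u huM, pow_mem (h.stable k) l u huW⟩
    (pow_mem (h.stable _) l w hw)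

/-- `Gr^M_{k+l} Gr^W_k` is identified with the joint eigenspace of `Y` and `Y'` for `(k + l, k)`,
where `Y - Y'` has weight `l`. There `N ^ l` acts as `N₀ ^ l`, which is an isomorphism onto weight
`-l` by `sl₂`-theory. -/
theorem isRelativeWeightFiltration [FiniteDimensional K V] (h : IsSplitSl2 B W M N N₀ E Y' Y)
    (hM : ∀ k, ∀ x ∈ M k, N x ∈ M (k - 2)) : IsRelativeWeightFiltration N W M where
  filtration := h.gradM.isFiltration h.bddM
  lowers := hM
  iso k l := by
    refine inducesIso_iff.mpr ⟨fun x hx => ?_, fun x _ hx => ?_, fun x hx hx' => ?_,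
      fun y hy => ?_⟩
    · convert h.pow_mem_grStep hM l hx using 2; ring
    · convert h.pow_mem_grStep hM l hx using 2; ring
    · rw [h.mem_grStep] at hx hx' ⊢
      refine ⟨hx.1, fun a ha => ?_⟩
      rcases eq_or_ne a (k + l) with rfl | hne
      · have h1 := hx'.2 (k - l) (by omega)
        rw [h.proj_pow_apply hx.1, show k - (l : ℤ) = k + l - 2 * l by ring,
          h.proj_pow_shift] at h1
        refine h.sl2.injective ?_ h1
        rw [h.weight]; congr 1; push_cast; ring
      · exact hx.2 a (by omega)
    · rw [h.mem_grStep] at hy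
      obtain ⟨x₀, hx₀, hN⟩ := h.sl2.surjective (m := l) (y := proj B Y (k - l) (proj B Y' k y)) (by
        rw [h.weight]; congr 1; push_cast; ring)
      have hmem : proj B Y (k + l) (proj B Y' k x₀) ∈ W k :=
        h.proj_mem_W _ (h.gradW.proj_mem h.bddW le_rfl x₀)
      refine ⟨proj B Y (k + l) (proj B Y' k x₀), ?_, ?_⟩
      · rw [h.mem_grStep]
        refine ⟨hmem, fun a ha => ?_⟩
        rw [← h.commute_proj_proj, proj_proj h.bddW, if_pos rfl, proj_proj h.bddM,
          if_neg (by omega)]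
      · rw [h.mem_grStep]
        refine ⟨(W k).sub_mem hy.1 (pow_mem (h.stable k) l _ hmem), fun a ha => ?_⟩
        rw [map_sub, h.proj_pow_apply hmem, ← h.commute_proj_proj (k + l), proj_proj h.bddW,
          if_pos rfl, ← h.proj_pow_shift, commute_proj_apply (h.comm₀.pow_left l), hN,
          h.commute_proj_proj (k - l), proj_proj h.bddW, if_pos rfl,
          show k + (l : ℤ) - 2 * l = k - l by ring, ← h.commute_proj_proj (k - l), proj_proj h.bddM,
          if_pos rfl, map_sub, proj_proj h.bddM]
        split_ifs with e
        · rw [e, sub_self]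
        · rw [hy.2 a (by omega), sub_zero]

theorem restrict (h : IsSplitSl2 B W M N N₀ E Y' Y) {U : Submodule K V}
    (hN : ∀ x ∈ U, N x ∈ U) (hN₀ : ∀ x ∈ U, N₀ x ∈ U) (hE : ∀ x ∈ U, E x ∈ U)
    (hY' : ∀ x ∈ U, Y' x ∈ U) (hY : ∀ x ∈ U, Y x ∈ U) :
    IsSplitSl2 B (restrictFiltration W U) (restrictFiltration M U) (N.restrict hN)
      (N₀.restrict hN₀) (E.restrict hE) (Y'.restrict hY') (Y.restrict hY) where
  gradW := h.gradW.restrict h.bddW hY'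
  gradM := h.gradM.restrict h.bddM hY
  bddW := h.bddW.restrict hY'
  bddM := h.bddM.restrict hY
  comm := LinearMap.ext fun x => Subtype.ext (LinearMap.congr_fun h.comm x)
  comm₀ := LinearMap.ext fun x => Subtype.ext (LinearMap.congr_fun h.comm₀ x)
  sl2 := h.sl2.restrict hN₀ (fun x hx => U.sub_mem (hY x hx) (hY' x hx)) hE
  stable k x hx := h.stable k x hx
  lead k x hx := h.lead k x hx

/-- The degree zero component of an operator which preserves `W` has the same action on `Gr^W`. -/
theorem lead_of_isZeroComponent {Y' N N₀ : Module.End K V} (hW : IsGrading Y' W)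
    (hY' : IsBounded B Y') (hN : ∀ k, ∀ x ∈ W k, N x ∈ W k) (h₀ : IsZeroComponent Y' N N₀) :
    Commute N₀ Y' ∧ ∀ k, ∀ x ∈ W k, N x - N₀ x ∈ W (k - 1) := by
  have key : ∀ b x, N₀ (proj B Y' b x) = proj B Y' b (N (proj B Y' b x)) := by
    intro b x
    rw [h₀.eq_sum hY', LinearMap.sum_apply]
    simp only [Module.End.mul_apply, proj_proj hY']
    rw [Finset.sum_eq_single b]
    · rw [if_pos rfl]
    · intro c _ hc
      rw [if_neg (Ne.symm hc), map_zero, map_zero]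
    · intro hb
      rw [if_pos rfl, proj_of_not_mem Y' hb]; rfl
  have key' : ∀ (b : ℤ) x, Y' x = (b : K) • x → N₀ x = proj B Y' b (N x) := by
    intro b x hx
    have := key b x
    rwa [proj_of_eigen hY' hx, if_pos rfl] at this
  constructor
  · refine LinearMap.ext fun x => ?_
    refine hom_ext_eigen hY' (f := N₀ * Y') (g := Y' * N₀) (fun b x hx => ?_) x
    rw [Module.End.mul_apply, Module.End.mul_apply, hx, map_smul, key' b x hx, apply_proj hY']
  · intro k x hx
    suffices W k ≤ (W (k - 1)).comap (N - N₀) from this hx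
    conv_lhs => rw [hW.filtration_eq k]
    refine iSup_le fun j => iSup_le fun hj y hy => ?_
    rw [Module.End.mem_eigenspace_iff] at hy
    rw [Submodule.mem_comap, LinearMap.sub_apply, key' j y hy]
    exact hW.mono (by omega) (hW.sub_proj_mem hY' (hN j y (hW.mem_of_eigen le_rfl hy)))

end IsSplitSl2
end RelativeWeight
end DeligneSys

namespace DeligneSys

/-! ### `sl₂`-actions on spaces of homomorphisms, quotients and subspaces. -/

section Hom

variable {K : Type*} [Field K] {V V' : Type*} [AddCommGroup V] [Module K V]
  [AddCommGroup V'] [Module K V']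

/-- The endomorphism `X ↦ b ∘ X - X ∘ a` of `Hom(V, V')`. -/
def homAd (a : Module.End K V) (b : Module.End K V') : Module.End K (V →ₗ[K] V') where
  toFun X := b ∘ₗ X - X ∘ₗ a
  map_add' X X' := by rw [LinearMap.comp_add, LinearMap.add_comp]; abel
  map_smul' c X := by
    rw [LinearMap.comp_smul, LinearMap.smul_comp, RingHom.id_apply, smul_sub]

theorem homAd_apply (a : Module.End K V) (b : Module.End K V') (X : V →ₗ[K] V') (x : V) :
    homAd a b X x = b (X x) - X (a x) := rfl

theorem lie_homAd (a a' : Module.End K V) (b b' : Module.End K V') :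
    ⁅homAd a b, homAd a' b'⁆ = homAd ⁅a, a'⁆ ⁅b, b'⁆ := by
  ext X x
  simp only [Ring.lie_def, LinearMap.sub_apply, Module.End.mul_apply, homAd_apply, map_sub]
  abel

theorem homAd_smul (c : K) (a : Module.End K V) (b : Module.End K V') :
    homAd (c • a) (c • b) = c • homAd a b := by
  ext X x
  simp only [homAd_apply, LinearMap.smul_apply, map_smul, smul_sub]

theorem IsSl2Rep.hom {F H E : Module.End K V} {F' H' E' : Module.End K V'}
    (h : IsSl2Rep F H E) (h' : IsSl2Rep F' H' E') :
    IsSl2Rep (homAd F F') (homAd H H') (homAd E E') where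
  lie_pos_neg := by rw [lie_homAd, h.lie_pos_neg, h'.lie_pos_neg]
  lie_cartan_pos := by rw [lie_homAd, h.lie_cartan_pos, h'.lie_cartan_pos, homAd_smul]
  lie_cartan_neg := by rw [lie_homAd, h.lie_cartan_neg, h'.lie_cartan_neg, homAd_smul]

theorem IsSl2Rep.quotient {F H E : Module.End K V} (h : IsSl2Rep F H E) {U : Submodule K V}
    (hF : U ≤ U.comap F) (hH : U ≤ U.comap H) (hE : U ≤ U.comap E) :
    IsSl2Rep (U.mapQ U F hF) (U.mapQ U H hH) (U.mapQ U E hE) where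
  lie_pos_neg := by
    refine LinearMap.ext fun q => ?_
    obtain ⟨x, rfl⟩ := U.mkQ_surjective q
    exact congrArg U.mkQ (LinearMap.congr_fun h.lie_pos_neg x)
  lie_cartan_pos := by
    refine LinearMap.ext fun q => ?_
    obtain ⟨x, rfl⟩ := U.mkQ_surjective q
    exact congrArg U.mkQ (LinearMap.congr_fun h.lie_cartan_pos x)
  lie_cartan_neg := by
    refine LinearMap.ext fun q => ?_
    obtain ⟨x, rfl⟩ := U.mkQ_surjective q
    exact congrArg U.mkQ (LinearMap.congr_fun h.lie_cartan_neg x)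

/-- In a subspace stable under `F` and `H` in which `F ^ m` maps the space of weight `m` onto that
of weight `-m` for all `m`, the third element of the `sl₂`-triple acts as well. -/
theorem IsSl2Rep.stable_of_surjective [CharZero K] [FiniteDimensional K V] {B : ℕ}
    {F H E : Module.End K V} (h : IsSl2Rep F H E) (hB : IsBounded B H) {U : Submodule K V}
    (hF : ∀ x ∈ U, F x ∈ U) (hH : ∀ x ∈ U, H x ∈ U)
    (hs : ∀ m : ℕ, ∀ y ∈ U, H y = (-m : K) • y → ∃ x ∈ U, H x = (m : K) • x ∧ (F ^ m) x = y) :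
    ∀ x ∈ U, E x ∈ U := by
  obtain ⟨M, hM⟩ := exists_weight_bound H
  -- Descending induction on the weight `m`. Since `F^(m+1) u` has weight `-(m + 2)`, it equals
  -- `F^(m+2) u'` with `u'` in `U` of weight `m + 2`. Then `u - F u'` is primitive, so `E` acts on
  -- its `F`-string inside `U`, and `u'` is covered by induction.
  have key : ∀ d m : ℕ, M < m + d → ∀ u ∈ U, H u = (m : K) • u → ∀ i, E ((F ^ i) u) ∈ U := by
    intro d
    induction d with
    | zero =>
      intro m hm u hu hw i
      rw [hM m hm u hw, map_zero, map_zero]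
      exact U.zero_mem
    | succ d ih =>
      intro m hm u hu hw i
      have hw1 : H ((F ^ (m + 1)) u) = (-(m + 2 : ℕ) : K) • (F ^ (m + 1)) u := by
        rw [h.weight_neg_pow hw]; congr 1; push_cast; ring
      obtain ⟨u', hu', hw', e⟩ := hs (m + 2) _ (pow_mem hF (m + 1) u hu) hw1
      have hwF : H (F u') = (m : K) • F u' := by
        rw [h.weight_neg hw']; congr 1; push_cast; ring
      have hp : E (u - F u') = 0 := by
        apply h.primitive (m := m)
        · rw [map_sub, hw, hwF, smul_sub]
        · rw [map_sub, ← e, ← Module.End.mul_apply (F ^ (m + 1)), ← pow_succ, sub_self]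
      have hsplit : E ((F ^ i) u) = E ((F ^ i) (u - F u')) + E ((F ^ (i + 1)) u') := by
        rw [← map_add, pow_succ, Module.End.mul_apply, ← map_add, sub_add_cancel]
      rw [hsplit]
      refine U.add_mem ?_ (ih (m + 2) (by omega) u' hu' hw' (i + 1))
      have hpU : u - F u' ∈ U := U.sub_mem hu (hF _ hu')
      have hpw : H (u - F u') = (m : K) • (u - F u') := by rw [map_sub, hw, hwF, smul_sub]
      rcases i with _ | i
      · rw [pow_zero, Module.End.one_apply, hp]; exact U.zero_mem
      · rw [h.pos_neg_pow hpw, hp, map_zero, zero_add]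
        exact U.smul_mem _ (pow_mem hF i _ hpU)
  intro x hx
  rw [← sum_proj_apply B H x, map_sum]
  refine U.sum_mem fun j _ => ?_
  have hj := apply_proj hB j x
  have hjU := proj_mem (B := B) hH j hx
  obtain ⟨m, rfl | rfl⟩ := j.eq_nat_or_neg
  · exact key (M + 1) m (by omega) _ hjU (by rw [hj]; simp) 0
  · obtain ⟨u, hu, hw, e⟩ := hs m _ hjU (by rw [hj]; simp)
    rw [← e]
    exact key (M + 1) m (by omega) u hu hw m

end Hom

/-! ### The graded space of a subspace is an `sl₂`-submodule. -/

section Leading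

variable {K : Type*} [Field K] {V : Type*} [AddCommGroup V] [Module K V]

/-- The associated graded space of the filtration induced by `W` on `U`, as a subspace of `V` by
means of the grading `Y'` of `W`. -/
noncomputable def leadingSubspace (B : ℕ) (W : ℤ → Submodule K V) (Y' : Module.End K V)
    (U : Submodule K V) : Submodule K V :=
  ⨅ b, ((U ⊓ W b).map (proj B Y' b)).comap (proj B Y' b)

theorem mem_leadingSubspace {B : ℕ} {W : ℤ → Submodule K V} {Y' : Module.End K V}
    {U : Submodule K V} {x : V} : x ∈ leadingSubspace B W Y' U ↔
      ∀ b, ∃ u, (u ∈ U ∧ u ∈ W b) ∧ proj B Y' b u = proj B Y' b x := by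
  simp only [leadingSubspace, Submodule.mem_iInf, Submodule.mem_comap, Submodule.mem_map,
    Submodule.mem_inf]

namespace IsSplitSl2

variable [CharZero K] {B : ℕ} {W M : ℤ → Submodule K V} {N N₀ E Y' Y : Module.End K V}
  {U : Submodule K V}

theorem proj_mem_leading (h : IsSplitSl2 B W M N N₀ E Y' Y) {u : V} {b : ℤ} (hu : u ∈ U)
    (hub : u ∈ W b) : proj B Y' b u ∈ leadingSubspace B W Y' U := by
  rw [mem_leadingSubspace]
  intro c
  by_cases hc : b = c
  · subst hc
    exact ⟨u, ⟨hu, hub⟩, by rw [proj_proj h.bddW, if_pos rfl]⟩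
  · exact ⟨0, ⟨U.zero_mem, (W c).zero_mem⟩, by rw [proj_proj h.bddW, if_neg hc, map_zero]⟩

omit [CharZero K] in
theorem grading_leading (h : IsSplitSl2 B W M N N₀ E Y' Y) {x : V}
    (hx : x ∈ leadingSubspace B W Y' U) : Y' x ∈ leadingSubspace B W Y' U := by
  rw [mem_leadingSubspace] at hx ⊢
  intro b
  obtain ⟨u, ⟨hu, hub⟩, e⟩ := hx b
  refine ⟨(b : K) • u, ⟨U.smul_mem _ hu, (W b).smul_mem _ hub⟩, ?_⟩
  rw [map_smul, e, ← apply_proj h.bddW, commute_proj_apply (Commute.refl Y')]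

omit [CharZero K] in
theorem grading'_leading (h : IsSplitSl2 B W M N N₀ E Y' Y) (hY : ∀ x ∈ U, Y x ∈ U) {x : V}
    (hx : x ∈ leadingSubspace B W Y' U) : Y x ∈ leadingSubspace B W Y' U := by
  rw [mem_leadingSubspace] at hx ⊢
  intro b
  obtain ⟨u, ⟨hu, hub⟩, e⟩ := hx b
  refine ⟨Y u, ⟨hY u hu, h.gradW.map_mem h.comm.symm hub⟩, ?_⟩
  rw [← commute_proj_apply h.comm.symm, e, commute_proj_apply h.comm.symm]

theorem neg_leading (h : IsSplitSl2 B W M N N₀ E Y' Y) (hN : ∀ x ∈ U, N x ∈ U) {x : V}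
    (hx : x ∈ leadingSubspace B W Y' U) : N₀ x ∈ leadingSubspace B W Y' U := by
  rw [mem_leadingSubspace] at hx ⊢
  intro b
  obtain ⟨u, ⟨hu, hub⟩, e⟩ := hx b
  refine ⟨N u, ⟨hN u hu, h.stable b u hub⟩, ?_⟩
  rw [h.proj_apply hub, e, commute_proj_apply h.comm₀]

omit [CharZero K] in
theorem coe_mem_grStep {m k : ℤ} {x : U}
    (hx : x ∈ grStep (restrictFiltration M U) (restrictFiltration W U) m k) :
    (x : V) ∈ grStep M W m k := by
  obtain ⟨u, ⟨hu, hu'⟩, w, hw, rfl⟩ := Submodule.mem_sup.mp hx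
  exact Submodule.add_mem_sup ⟨hu, hu'⟩ hw

/-- The isomorphism `N ^ l` on the graded pieces of `U` is read through `proj B Y' k`, where `N`
becomes `N₀`. This is the hypothesis of `IsSl2Rep.stable_of_surjective`, which then gives stability
under `E`. -/
theorem surjective_leading [FiniteDimensional K V] (h : IsSplitSl2 B W M N N₀ E Y' Y)
    (hN : ∀ x ∈ U, N x ∈ U) (hY : ∀ x ∈ U, Y x ∈ U)
    (hR : IsRelativeWeightFiltration (N.restrict hN) (restrictFiltration W U)
      (restrictFiltration M U)) (l : ℕ) {y : V} (hy : y ∈ leadingSubspace B W Y' U)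
    (hyw : (Y - Y') y = (-l : K) • y) :
    ∃ x ∈ leadingSubspace B W Y' U, (Y - Y') x = (l : K) • x ∧ (N₀ ^ l) x = y := by
  let P : Submodule K V := leadingSubspace B W Y' U ⊓ Module.End.eigenspace (Y - Y') (l : K)
  suffices y ∈ P.map (N₀ ^ l) by
    obtain ⟨x, ⟨hx, hx'⟩, e⟩ := this
    exact ⟨x, hx, Module.End.mem_eigenspace_iff.mp hx', e⟩
  rw [← sum_proj_apply B Y' y]
  refine Submodule.sum_mem _ fun k _ => ?_
  obtain ⟨u, ⟨hu, huk⟩, e⟩ := mem_leadingSubspace.mp hy k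
  have hyk : proj B Y (k - l) (proj B Y' k y) = proj B Y' k y := by
    rw [proj_of_eigen h.bddM (i := k - l), if_pos rfl]
    have h1 : Y y = Y' y + (-l : K) • y := by rw [← hyw, LinearMap.sub_apply]; abel
    rw [commute_proj_apply h.comm.symm, h1, map_add, map_smul,
      ← commute_proj_apply (Commute.refl Y'), apply_proj h.bddW, ← add_smul]
    push_cast
    rw [sub_eq_add_neg]
  have hu'U : proj B Y (k - l) u ∈ U := proj_mem hY _ hu
  have hu'W : proj B Y (k - l) u ∈ W k := h.proj_mem_W _ huk
  obtain ⟨-, -, -, hs⟩ := inducesIso_iff.mp (hR.iso k l)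
  obtain ⟨x, hx, hxu⟩ := hs ⟨proj B Y (k - l) u, hu'U⟩
    (Submodule.mem_sup_left ⟨h.gradM.proj_mem h.bddM le_rfl _, hu'W⟩)
  have hxW : (x : V) ∈ W k := (h.mem_grStep.mp (coe_mem_grStep hx)).1
  have h2 := (h.mem_grStep.mp (coe_mem_grStep hxu)).2 (k - l) (by omega)
  have h3 : (((N.restrict hN) ^ l) x : V) = (N ^ l) (x : V) := by
    clear * -
    induction l with
    | zero => rfl
    | succ l ih =>
      rw [pow_succ', pow_succ', Module.End.mul_apply, Module.End.mul_apply, ← ih]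
      rfl
  rw [Submodule.coe_sub, h3, map_sub, map_sub, sub_eq_zero, h.proj_pow_apply hxW,
    h.commute_proj_proj, proj_proj h.bddM, if_pos rfl, ← h.commute_proj_proj, e, hyk,
    show k - (l : ℤ) = k + l - 2 * l by ring, h.proj_pow_shift] at h2
  refine ⟨proj B Y (k + l) (proj B Y' k x), ⟨?_, ?_⟩, h2.symm⟩
  · rw [h.commute_proj_proj]
    exact h.proj_mem_leading (proj_mem hY _ x.2) (h.proj_mem_W _ hxW)
  · refine Module.End.mem_eigenspace_iff.mpr ?_
    rw [h.weight]
    congr 1; push_cast; ring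

theorem pos_leading [FiniteDimensional K V] (h : IsSplitSl2 B W M N N₀ E Y' Y)
    (hN : ∀ x ∈ U, N x ∈ U) (hY : ∀ x ∈ U, Y x ∈ U)
    (hR : IsRelativeWeightFiltration (N.restrict hN) (restrictFiltration W U)
      (restrictFiltration M U)) {x : V} (hx : x ∈ leadingSubspace B W Y' U) :
    E x ∈ leadingSubspace B W Y' U :=
  h.sl2.stable_of_surjective (h.bddM.sub h.bddW h.comm.symm)
    (fun _ => h.neg_leading hN)
    (fun _ hx => Submodule.sub_mem _ (h.grading'_leading hY hx) (h.grading_leading hx))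
    (fun l _ hy hyw => h.surjective_leading hN hY hR l hy hyw) x hx

end IsSplitSl2
end Leading
end DeligneSys

namespace DeligneSys

/-! ### Compatibility of Deligne's grading with subspaces. -/

section Splitting

variable {K : Type*} [Field K] {V : Type*} [AddCommGroup V] [Module K V]

/-- A linear map of degree zero for `Y` which maps the graded space associated to `U` to `U`, and
which differs from the identity by terms lowering the weight by `k`. -/
structure IsLift (B : ℕ) (W : ℤ → Submodule K V) (Y' Y : Module.End K V) (U : Submodule K V)
    (k : ℤ) (g : Module.End K V) : Prop where
  map_mem : ∀ x ∈ leadingSubspace B W Y' U, g x ∈ U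
  comm : Commute g Y
  sub_mem : ∀ (b : ℤ), ∀ x ∈ leadingSubspace B W Y' U, Y' x = (b : K) • x → g x - x ∈ W (b - k)

namespace IsSplitSl2

variable [CharZero K] {B : ℕ} {W M : ℤ → Submodule K V} {N N₀ E Y' Y : Module.End K V}
  {U : Submodule K V}

/-- `[E, Y']` has weight 2 under `Y - Y'` and commutes with `N₀`, because `Y'` commutes with `N₀`
and with `Y - Y'`. A vector of positive weight killed by the lowering operator is zero. -/
theorem commute_pos [FiniteDimensional K V] (h : IsSplitSl2 B W M N N₀ E Y' Y) :
    Commute E Y' := by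
  have hH : (Y - Y') * Y' = Y' * (Y - Y') := by rw [sub_mul, mul_sub, h.comm.eq]
  have hEF : E * N₀ = N₀ * E + (Y - Y') := by
    rw [← h.sl2.lie_pos_neg, Ring.lie_def]; abel
  have hHE : (Y - Y') * E = E * (Y - Y') + (2 : K) • E := by
    rw [← h.sl2.lie_cartan_pos, Ring.lie_def]; abel
  have hF : N₀ * Y' = Y' * N₀ := h.comm₀
  have hD : E * Y' - Y' * E = 0 := by
    refine (h.sl2.hom h.sl2).eq_zero_of_pos (k := 1) ?_ ?_
    · change (Y - Y') * (E * Y' - Y' * E) - (E * Y' - Y' * E) * (Y - Y') = _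
      generalize Y - Y' = H at *
      calc H * (E * Y' - Y' * E) - (E * Y' - Y' * E) * H
          = (H * E) * Y' - (H * Y') * E - E * (Y' * H) + Y' * (E * H) := by noncomm_ring
        _ = (E * H + (2 : K) • E) * Y' - (Y' * H) * E - E * (H * Y') + Y' * (E * H) := by
          rw [hHE, hH]
        _ = (2 : K) • E * Y' - Y' * (H * E) + Y' * (E * H) := by noncomm_ring
        _ = (2 : K) • E * Y' - Y' * ((2 : K) • E) := by rw [hHE]; noncomm_ring
        _ = _ := by rw [smul_mul_assoc, mul_smul_comm, ← smul_sub]; norm_num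
    · have : homAd N₀ N₀ (E * Y' - Y' * E) = 0 := by
        change N₀ * (E * Y' - Y' * E) - (E * Y' - Y' * E) * N₀ = 0
        calc N₀ * (E * Y' - Y' * E) - (E * Y' - Y' * E) * N₀
            = N₀ * E * Y' - (N₀ * Y') * E - E * (Y' * N₀) + Y' * (E * N₀) := by noncomm_ring
          _ = N₀ * E * Y' - Y' * (N₀ * E) - (E * N₀) * Y' + Y' * (E * N₀) := by
            rw [← hF, mul_assoc E, hF]; noncomm_ring
          _ = Y' * (Y - Y') - (Y - Y') * Y' := by rw [hEF]; noncomm_ring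
          _ = 0 := by rw [hH, sub_self]
      rw [this, map_zero]
  exact sub_eq_zero.mp hD

theorem exists_isLift (h : IsSplitSl2 B W M N N₀ E Y' Y) (hY : ∀ x ∈ U, Y x ∈ U) :
    ∃ g, IsLift B W Y' Y U 1 g := by
  have hs : ∀ b, ∃ s : Module.End K V, ∀ z ∈ (U ⊓ W b).map (proj B Y' b),
      s z ∈ U ⊓ W b ∧ proj B Y' b (s z) = z := by
    intro b
    obtain ⟨t, ht⟩ := ((proj B Y' b).submoduleMap (U ⊓ W b)).exists_rightInverse_of_surjective
      (LinearMap.range_eq_top.mpr ((proj B Y' b).submoduleMap_surjective _))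
    obtain ⟨s, hs⟩ := LinearMap.exists_extend ((U ⊓ W b).subtype ∘ₗ t)
    refine ⟨s, fun z hz => ?_⟩
    have h1 : s z = (t ⟨z, hz⟩ : V) := LinearMap.congr_fun hs ⟨z, hz⟩
    rw [h1]
    exact ⟨(t ⟨z, hz⟩).2, congrArg Subtype.val (LinearMap.congr_fun ht ⟨z, hz⟩)⟩
  choose s hs using hs
  -- The linear sections `s b` of the leading-term maps are cut by the eigenprojectors of `Y` on
  -- both sides, which forces commutation with `Y` and keeps the values in `U`.
  let g : Module.End K V := ∑ b ∈ window B, ∑ a ∈ window B,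
    proj B Y a * s b * proj B Y' b * proj B Y a
  have hg : ∀ x, g x = ∑ b ∈ window B, ∑ a ∈ window B,
      proj B Y a (s b (proj B Y' b (proj B Y a x))) := by
    intro x
    simp [g, LinearMap.sum_apply]
  have hterm : ∀ a b, ∀ x ∈ leadingSubspace B W Y' U,
      proj B Y a (s b (proj B Y' b (proj B Y a x))) ∈ U ⊓ W b ∧
      proj B Y' b (proj B Y a (s b (proj B Y' b (proj B Y a x)))) =
        proj B Y' b (proj B Y a x) := by
    intro a b x hx
    have h1 : proj B Y a x ∈ leadingSubspace B W Y' U :=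
      DeligneSys.proj_mem (fun _ => h.grading'_leading hY) a hx
    have h2 : proj B Y' b (proj B Y a x) ∈ (U ⊓ W b).map (proj B Y' b) :=
      (Submodule.mem_iInf _).mp h1 b
    obtain ⟨h3, h4⟩ := hs b _ h2
    refine ⟨⟨DeligneSys.proj_mem hY a h3.1, h.proj_mem_W a h3.2⟩, ?_⟩
    rw [← h.commute_proj_proj, h4, h.commute_proj_proj, proj_proj h.bddM, if_pos rfl]
  refine ⟨g, fun x hx => ?_, ?_, fun b x hx hbx => ?_⟩
  · rw [hg]
    exact U.sum_mem fun b _ => U.sum_mem fun a _ => (hterm a b x hx).1.1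
  · refine LinearMap.ext fun x => ?_
    rw [Module.End.mul_apply, Module.End.mul_apply, hg, hg, map_sum]
    refine Finset.sum_congr rfl fun b _ => ?_
    rw [map_sum]
    refine Finset.sum_congr rfl fun a _ => ?_
    rw [← commute_proj_apply (Commute.refl Y), apply_proj h.bddM, apply_proj h.bddM, map_smul,
      map_smul, map_smul]
  · have hzero : ∀ c ∈ window B, c ≠ b → ∑ a ∈ window B,
        proj B Y a (s c (proj B Y' c (proj B Y a x))) = 0 := by
      intro c _ hc
      refine Finset.sum_eq_zero fun a _ => ?_
      rw [← h.commute_proj_proj, proj_of_eigen h.bddW hbx, if_neg hc.symm]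
      simp
    by_cases hb : b ∈ window B
    · rw [hg, Finset.sum_eq_single_of_mem b hb hzero]
      have h1 : ∑ a ∈ window B, proj B Y a (s b (proj B Y' b (proj B Y a x))) ∈ W b :=
        Submodule.sum_mem _ fun a _ => (hterm a b x hx).1.2
      have h2 := h.gradW.sub_proj_mem h.bddW h1
      rw [map_sum, Finset.sum_congr rfl fun a _ => (hterm a b x hx).2, ← map_sum,
        sum_proj_apply, proj_of_eigen h.bddW hbx, if_pos rfl] at h2
      exact h2
    · have hx0 : x = 0 := by
        have := proj_of_eigen h.bddW hbx b
        rw [if_pos rfl, proj_of_not_mem Y' hb] at this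
        exact this.symm
      rw [hx0, map_zero, sub_zero]
      exact Submodule.zero_mem _

omit [CharZero K] in
theorem proj_leading (h : IsSplitSl2 B W M N N₀ E Y' Y) (b : ℤ) {x : V}
    (hx : x ∈ leadingSubspace B W Y' U) : proj B Y' b x ∈ leadingSubspace B W Y' U :=
  DeligneSys.proj_mem (fun _ => h.grading_leading) b hx

theorem _root_.DeligneSys.IsLift.sub_mem_of_mem (h : IsSplitSl2 B W M N N₀ E Y' Y) {k : ℤ}
    {g : Module.End K V} (hg : IsLift B W Y' Y U k g) {b : ℤ} {x : V}
    (hx : x ∈ leadingSubspace B W Y' U) (hb : x ∈ W b) : g x - x ∈ W (b - k) := by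
  have h1 : g x - x = ∑ c ∈ window B, (g (proj B Y' c x) - proj B Y' c x) := by
    rw [Finset.sum_sub_distrib, ← map_sum, sum_proj_apply]
  rw [h1]
  refine Submodule.sum_mem _ fun c _ => ?_
  by_cases hc : c ≤ b
  · exact h.gradW.mono (by omega)
      (hg.sub_mem c _ (h.proj_leading c hx) (apply_proj h.bddW c x))
  · rw [(h.gradW.mem_iff h.bddW).mp hb c (by omega), map_zero, sub_zero]
    exact Submodule.zero_mem _

theorem eq_zero_of_mem (h : IsSplitSl2 B W M N N₀ E Y' Y) {b : ℤ} (hb : b < -(B : ℤ)) {x : V}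
    (hx : x ∈ W b) : x = 0 := by
  rw [← sum_proj_apply B Y' x]
  refine Finset.sum_eq_zero fun j hj => (h.gradW.mem_iff h.bddW).mp hx j ?_
  rw [Finset.mem_Icc] at hj
  omega

/-- Successive approximation: the leading term of `u` lies in the graded space, and subtracting its
lift lowers the weight of `u`. The process ends because `W` vanishes below `-B`. -/
theorem _root_.DeligneSys.IsLift.surjective (h : IsSplitSl2 B W M N N₀ E Y' Y) {k : ℤ}
    (hk : 1 ≤ k) {g : Module.End K V} (hg : IsLift B W Y' Y U k g) {b : ℤ} {u : V}
    (hu : u ∈ U) (hb : u ∈ W b) : ∃ n ∈ leadingSubspace B W Y' U, n ∈ W b ∧ g n = u := by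
  suffices ∀ (n : ℕ) (b : ℤ), b < -(B : ℤ) + n → ∀ u ∈ U, u ∈ W b →
      ∃ n ∈ leadingSubspace B W Y' U, n ∈ W b ∧ g n = u from
    this (b + B + 1).toNat b (by omega) u hu hb
  intro n
  induction n with
  | zero =>
    intro b hb u _ hub
    refine ⟨0, Submodule.zero_mem _, Submodule.zero_mem _, ?_⟩
    rw [h.eq_zero_of_mem (by omega) hub, map_zero]
  | succ n ih =>
    intro b hb u hu hub
    have h1 : proj B Y' b u ∈ leadingSubspace B W Y' U := h.proj_mem_leading hu hub
    have h2 := h.gradW.mono (by omega : b - k ≤ b - 1)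
      (hg.sub_mem b _ h1 (apply_proj h.bddW b u))
    have h3 : u - g (proj B Y' b u) ∈ W (b - 1) := by
      rw [show u - g (proj B Y' b u) =
        (u - proj B Y' b u) - (g (proj B Y' b u) - proj B Y' b u) by abel]
      exact Submodule.sub_mem _ (h.gradW.sub_proj_mem h.bddW hub) h2
    obtain ⟨m, hm, hmb, e⟩ := ih (b - 1) (by push_cast at hb; omega) _
      (U.sub_mem hu (hg.map_mem _ h1)) h3
    refine ⟨proj B Y' b u + m, Submodule.add_mem _ h1 hm,
      Submodule.add_mem _ (h.gradW.proj_mem h.bddW le_rfl u) (h.gradW.mono (by omega) hmb), ?_⟩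
    rw [map_add, e, add_sub_cancel]

/-- The component of degree `-k` of an operator, with respect to `Y'`. -/
noncomputable def lowerComponent (B : ℕ) (Y' : Module.End K V) (k : ℤ) (A : Module.End K V) :
    Module.End K V :=
  ∑ b ∈ window B, proj B Y' (b - k) * A * proj B Y' b

theorem lowerComponent_apply {Y' : Module.End K V} (hY' : IsBounded B Y') (k : ℤ)
    (A : Module.End K V) {b : ℤ} {x : V} (hx : Y' x = (b : K) • x) :
    lowerComponent B Y' k A x = proj B Y' (b - k) (A x) := by
  rw [lowerComponent, LinearMap.sum_apply]
  simp only [Module.End.mul_apply, proj_of_eigen hY' hx]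
  by_cases hb : b ∈ window B
  · rw [Finset.sum_eq_single_of_mem b hb]
    · rw [if_pos rfl]
    · intro c _ hc
      rw [if_neg hc.symm, map_zero, map_zero]
  · have hx0 : x = 0 := by
      have := proj_of_eigen hY' hx b
      rw [if_pos rfl, proj_of_not_mem Y' hb] at this
      exact this.symm
    simp [hx0]

/-- The leading error `G` of the lift defines a class in `Hom(L, V/L)`. It has positive weight `k +
1`, and stability of `U` under `N` shows that applying `ad N₀` to it gives minus the class of the
degree `-(k + 1)` part `D` of `N`. Deligne's condition makes `D` commute with `E`, so
`IsSl2Rep.eq_zero_of_pos` applies. -/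
theorem lowerComponent_lift_mem [FiniteDimensional K V] (h : IsSplitSl2 B W M N N₀ E Y' Y)
    (hNE : ⁅N - N₀, E⁆ = 0) (hN : ∀ x ∈ U, N x ∈ U) (hY : ∀ x ∈ U, Y x ∈ U)
    (hE : ∀ x ∈ leadingSubspace B W Y' U, E x ∈ leadingSubspace B W Y' U)
    (k : ℕ) {g : Module.End K V} (hg : IsLift B W Y' Y U (k + 1 : ℕ) g) :
    ∀ x ∈ leadingSubspace B W Y' U,
      lowerComponent B Y' (k + 1 : ℕ) g x ∈ leadingSubspace B W Y' U := by
  set L := leadingSubspace B W Y' U with hL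
  set G := lowerComponent B Y' (k + 1 : ℕ) g with hG
  set D := lowerComponent B Y' (k + 1 : ℕ) N with hD
  have hk : (1 : ℤ) ≤ (k + 1 : ℕ) := by push_cast; omega
  generalize hkk : ((k + 1 : ℕ) : ℤ) = κ at *
  have hGY : Commute Y G := by
    refine Commute.sum_right _ _ _ fun b _ => ?_
    exact ((commute_proj h.comm.symm _).mul_right hg.comm.symm).mul_right
      (commute_proj h.comm.symm _)
  -- `G` has degree `0` for `Y` and `-κ` for `Y'`, hence degree `+κ` for `Y - Y'`: lowering `W`
  -- raises the `sl₂`-weight.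
  have hGw : ∀ x, (Y - Y') (G x) = G ((Y - Y') x) + (κ : K) • G x := by
    intro x
    refine hom_ext_eigen h.bddW (f := (Y - Y') * G) (g := G * (Y - Y') + (κ : K) • G)
      (fun b x hx => ?_) x
    have h1 : Y (G x) = G (Y x) := LinearMap.congr_fun hGY x
    simp only [LinearMap.sub_apply, Module.End.mul_apply, LinearMap.add_apply,
      LinearMap.smul_apply, map_sub, h1]
    rw [hx, map_smul, hG, lowerComponent_apply h.bddW κ g hx, apply_proj h.bddW]
    push_cast
    module
  have hF : ∀ x ∈ L, N₀ x ∈ L := fun _ => h.neg_leading hN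
  have hH : ∀ x ∈ L, (Y - Y') x ∈ L :=
    fun _ hx => L.sub_mem (h.grading'_leading hY hx) (h.grading_leading hx)
  -- `[E, N] = [E, N₀] = Y - Y'` has `Y'`-degree zero, and `E` commutes with `Y'`; so the component
  -- of `N` of degree `-κ ≠ 0` commutes with `E`.
  have hED : ∀ x, E (D x) = D (E x) := by
    intro x
    refine hom_ext_eigen h.bddW (f := E * D) (g := D * E) (fun b x hx => ?_) x
    have h0 : Y' (E x) = (b : K) • E x := by
      have := LinearMap.congr_fun h.commute_pos x
      simp only [Module.End.mul_apply, hx, map_smul] at this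
      exact this.symm
    have h1 : Y' ((Y - Y') x) = (b : K) • (Y - Y') x := by
      have := LinearMap.congr_fun h.comm x
      simp only [Module.End.mul_apply, hx, map_smul] at this
      rw [LinearMap.sub_apply, map_sub, this, hx, map_smul, hx, smul_sub]
    have h2 : E (N x) = N (E x) + (Y - Y') x := by
      have h3 := LinearMap.congr_fun hNE x
      have h4 := h.sl2.pos_neg x
      simp only [Ring.lie_def, LinearMap.sub_apply, Module.End.mul_apply, map_sub,
        LinearMap.zero_apply] at h3 h4
      rw [h4, sub_eq_zero, eq_sub_iff_add_eq] at h3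
      rw [LinearMap.sub_apply, ← h3]
      abel
    rw [Module.End.mul_apply, Module.End.mul_apply, hD, lowerComponent_apply h.bddW κ N hx,
      lowerComponent_apply h.bddW κ N h0, commute_proj_apply h.commute_pos, h2, map_add,
      proj_of_eigen h.bddW h1, if_neg (by omega), add_zero]
  -- For `x` of weight `b`, the vector `N (g x)` lies in `U` and is therefore `g n` with `n ∈ L`.
  -- Comparing components of weight `b` gives `N₀ x` as leading term of `n`; comparing those of
  -- weight `b - κ` expresses the left side as a component of `n`.
  have key : ∀ x ∈ L, N₀ (G x) - G (N₀ x) + D x ∈ L := by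
    intro x hx
    suffices ∀ b, N₀ (G (proj B Y' b x)) - G (N₀ (proj B Y' b x)) + D (proj B Y' b x) ∈ L by
      rw [← sum_proj_apply B Y' x]
      simp only [map_sum]
      rw [← Finset.sum_sub_distrib, ← Finset.sum_add_distrib]
      exact L.sum_mem fun b _ => this b
    intro b
    have hxL : proj B Y' b x ∈ L := h.proj_leading b hx
    have hbx := apply_proj h.bddW b x
    have hxW : proj B Y' b x ∈ W b := h.gradW.proj_mem h.bddW le_rfl x
    generalize proj B Y' b x = x at *
    have hr := hg.sub_mem b x hxL hbx
    have hgx : g x ∈ W b := by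
      rw [← add_sub_cancel x (g x)]
      exact Submodule.add_mem _ hxW (h.gradW.mono (by omega) hr)
    obtain ⟨n, hnL, hnW, hn⟩ := hg.surjective h hk (hN _ (hg.map_mem x hxL)) (h.stable _ _ hgx)
    have hNr := h.stable _ _ hr
    have e1 : N (g x) = N x + N (g x - x) := by rw [← map_add, add_sub_cancel]
    have hGeq : ∀ z, Y' z = (b : K) • z → proj B Y' (b - κ) (g z - z) = G z := by
      intro z hz
      rw [map_sub, proj_of_eigen h.bddW hz, if_neg (by omega), sub_zero, hG,
        lowerComponent_apply h.bddW κ g hz]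
    have e2 : proj B Y' (b - κ) (N (g x)) = D x + N₀ (G x) := by
      rw [e1, map_add, h.proj_apply hr, hGeq x hbx, hD, lowerComponent_apply h.bddW κ N hbx]
    have e3 : proj B Y' b n = N₀ x := by
      have h1 := (h.gradW.mem_iff h.bddW).mp (hg.sub_mem_of_mem h hnL hnW) b (by omega)
      rw [map_sub, sub_eq_zero, hn, e1, map_add, h.proj_apply hxW, proj_of_eigen h.bddW hbx,
        if_pos rfl, (h.gradW.mem_iff h.bddW).mp hNr b (by omega), add_zero] at h1
      exact h1.symm
    have e4 : proj B Y' (b - κ) (g n) = proj B Y' (b - κ) n + G (N₀ x) := by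
      have h1 : n - proj B Y' b n ∈ W (b - 1) := h.gradW.sub_proj_mem h.bddW hnW
      have h2 : n - proj B Y' b n ∈ L := L.sub_mem hnL (h.proj_leading b hnL)
      have h3 := (h.gradW.mem_iff h.bddW).mp (hg.sub_mem_of_mem h h2 h1) (b - κ) (by omega)
      have h4 := hGeq _ (apply_proj h.bddW b n)
      rw [← e3, ← h4, ← map_add, ← sub_eq_zero, ← map_sub, ← h3]
      congr 1
      rw [map_sub]
      abel
    rw [← hn, e4] at e2
    have e5 : N₀ (G x) - G (N₀ x) + D x = proj B Y' (b - κ) n := by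
      rw [← add_sub_cancel_right (proj B Y' (b - κ) n) (G (N₀ x)), e2]
      abel
    rw [e5]
    exact h.proj_leading _ hnL
  let X : L →ₗ[K] V ⧸ L := L.mkQ ∘ₗ G ∘ₗ L.subtype
  have hFX : ∀ x : L, homAd (N₀.restrict hF) (L.mapQ L N₀ hF) X x = -L.mkQ (D x) := by
    intro x
    have : L.mkQ (N₀ (G x) - G (N₀ x) + D x) = 0 :=
      (Submodule.Quotient.mk_eq_zero L).mpr (key x x.2)
    rw [map_add, map_sub, add_eq_zero_iff_eq_neg] at this
    rw [← this]
    rfl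
  have hX : X = 0 := by
    refine ((h.sl2.restrict hF hH hE).hom (h.sl2.quotient hF hH hE)).eq_zero_of_pos (k := k) ?_ ?_
    · refine LinearMap.ext fun x => ?_
      have h1 := congrArg L.mkQ (hGw x)
      rw [map_add, map_smul, ← sub_eq_iff_eq_add', ← hkk, Int.cast_natCast] at h1
      exact h1
    · refine LinearMap.ext fun x => ?_
      rw [homAd_apply, hFX, hFX, map_neg, LinearMap.zero_apply, sub_neg_eq_add,
        neg_add_eq_zero]
      exact congrArg L.mkQ (hED x)
  intro x hx
  have := LinearMap.congr_fun hX ⟨x, hx⟩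
  exact (Submodule.Quotient.mk_eq_zero L).mp this

/-- Since `G` maps the graded space to itself, `g * (1 - G)` still takes values in `U`, and the
error of degree `-(k + 1)` cancels. -/
theorem exists_isLift_succ [FiniteDimensional K V] (h : IsSplitSl2 B W M N N₀ E Y' Y)
    (hNE : ⁅N - N₀, E⁆ = 0) (hN : ∀ x ∈ U, N x ∈ U) (hY : ∀ x ∈ U, Y x ∈ U)
    (hE : ∀ x ∈ leadingSubspace B W Y' U, E x ∈ leadingSubspace B W Y' U) (k : ℕ) :
    ∃ g, IsLift B W Y' Y U (k + 1 : ℕ) g := by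
  induction k with
  | zero => simpa using h.exists_isLift hY
  | succ k ih =>
    obtain ⟨g, hg⟩ := ih
    have hGL := h.lowerComponent_lift_mem hNE hN hY hE k hg
    set G := lowerComponent B Y' (k + 1 : ℕ) g with hG
    have hGY : Commute G Y := by
      refine (Commute.sum_right _ _ _ fun b _ => ?_).symm
      exact ((commute_proj h.comm.symm _).mul_right hg.comm.symm).mul_right
        (commute_proj h.comm.symm _)
    refine ⟨g * (1 - G), fun x hx => ?_, ?_, fun b x hx hbx => ?_⟩
    · exact hg.map_mem _ (Submodule.sub_mem _ hx (hGL x hx))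
    · exact hg.comm.mul_left ((Commute.one_left Y).sub_left hGY)
    · have hr := hg.sub_mem b x hx hbx
      have h1 := h.gradW.sub_proj_mem h.bddW hr
      have hGx : G x = proj B Y' (b - (k + 1 : ℕ)) (g x) := lowerComponent_apply h.bddW _ g hbx
      rw [map_sub, proj_of_eigen h.bddW hbx, if_neg (by push_cast; omega), sub_zero,
        ← hGx] at h1
      have h2 := hg.sub_mem (b - (k + 1 : ℕ)) (G x) (hGL x hx) (by
        rw [hGx, apply_proj h.bddW])
      have h3 : (g * (1 - G)) x - x = (g x - x - G x) - (g (G x) - G x) := by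
        simp only [Module.End.mul_apply, LinearMap.sub_apply, Module.End.one_apply, map_sub]
        abel
      rw [h3]
      exact Submodule.sub_mem _ (h.gradW.mono (by push_cast; omega) h1)
        (h.gradW.mono (by push_cast; omega) h2)

/-- If `W` and `M` restrict on `U` to a filtration with its relative weight filtration, then the
grading `Y'` of `W` attached to `(W, N, Y)` and the `sl₂`-triple preserve `U`. -/
theorem stable_of_restrict [FiniteDimensional K V] (h : IsSplitSl2 B W M N N₀ E Y' Y)
    (hNE : ⁅N - N₀, E⁆ = 0) (hN : ∀ x ∈ U, N x ∈ U) (hY : ∀ x ∈ U, Y x ∈ U)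
    (hR : IsRelativeWeightFiltration (N.restrict hN) (restrictFiltration W U)
      (restrictFiltration M U)) :
    (∀ x ∈ U, Y' x ∈ U) ∧ ∀ x ∈ U, E x ∈ U := by
  have hE : ∀ x ∈ leadingSubspace B W Y' U, E x ∈ leadingSubspace B W Y' U :=
    fun _ => h.pos_leading hN hY hR
  -- The error of this lift lies in `W (B - (2B + 1)) = W (-B - 1)`, which is zero.
  obtain ⟨g, hg⟩ := h.exists_isLift_succ hNE hN hY hE (2 * B)
  have hid : ∀ x ∈ leadingSubspace B W Y' U, g x = x := by
    intro x hx
    have hxW : x ∈ W B := by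
      rw [h.gradW.mem_iff h.bddW]
      intro j hj
      rw [proj_of_not_mem, LinearMap.zero_apply]
      rw [Finset.mem_Icc]; omega
    exact sub_eq_zero.mp (h.eq_zero_of_mem (by push_cast; omega) (hg.sub_mem_of_mem h hx hxW))
  have hLU : leadingSubspace B W Y' U = U := by
    refine le_antisymm (fun x hx => ?_) (fun u hu => ?_)
    · rw [← hid x hx]
      exact hg.map_mem x hx
    · have huW : u ∈ W B := by
        rw [h.gradW.mem_iff h.bddW]
        intro j hj
        rw [proj_of_not_mem, LinearMap.zero_apply]
        rw [Finset.mem_Icc]; omega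
      obtain ⟨n, hn, -, e⟩ := hg.surjective h (by push_cast; omega) hu huW
      rw [← e, hid n hn]
      exact hn
  rw [hLU] at hE
  refine ⟨fun x hx => ?_, hE⟩
  rw [← hLU] at hx ⊢
  exact h.grading_leading hx

end IsSplitSl2
end Splitting
end DeligneSys

namespace DeligneSys

/-! ### Polynomial maps to `End V` and Zariski closed sets. -/

section Zariski

variable {K : Type*} [Field K] {A : Type*} [AddCommGroup A] [Module K A] [FiniteDimensional K A]
  {V : Type*} [AddCommGroup V] [Module K V] [FiniteDimensional K V]

/-- A map to `End V` whose matrix entries are polynomial functions. -/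
def IsPolyMap (F : A → Module.End K V) : Prop :=
  ∀ i j, ∃ p : MvPolynomial (Fin (Module.finrank K A)) K,
    ∀ x, MvPolynomial.eval ((Module.finBasis K A).equivFun x) p =
      LinearMap.toMatrix (Module.finBasis K V) (Module.finBasis K V) (F x) i j

theorem isPolyMap_const (C : Module.End K V) : IsPolyMap fun _ : A => C :=
  fun _ _ => ⟨MvPolynomial.C _, fun _ => MvPolynomial.eval_C _⟩

theorem isPolyMap_linear (F : A →ₗ[K] Module.End K V) : IsPolyMap F := by
  intro i j
  let f : A →ₗ[K] K := Matrix.entryLinearMap K K i j ∘ₗ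
    (LinearMap.toMatrix (Module.finBasis K V) (Module.finBasis K V)).toLinearMap ∘ₗ F
  refine ⟨∑ i, MvPolynomial.C (f (Module.finBasis K A i)) * MvPolynomial.X i, fun x => ?_⟩
  change _ = f x
  conv_rhs => rw [← (Module.finBasis K A).sum_equivFun x]
  rw [map_sum, map_sum]
  refine Finset.sum_congr rfl fun _ _ => ?_
  rw [map_mul, MvPolynomial.eval_C, MvPolynomial.eval_X, map_smul, smul_eq_mul, mul_comm]

namespace IsPolyMap

variable {F G : A → Module.End K V}

theorem add (hF : IsPolyMap F) (hG : IsPolyMap G) : IsPolyMap fun x => F x + G x := by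
  intro i j
  obtain ⟨p, hp⟩ := hF i j
  obtain ⟨q, hq⟩ := hG i j
  exact ⟨p + q, fun x => by rw [map_add, hp, hq, map_add, Matrix.add_apply]⟩

theorem smul (c : K) (hF : IsPolyMap F) : IsPolyMap fun x => c • F x := by
  intro i j
  obtain ⟨p, hp⟩ := hF i j
  exact ⟨c • p, fun x => by
    rw [MvPolynomial.smul_eval, hp, map_smul, Matrix.smul_apply, smul_eq_mul]⟩

theorem sub (hF : IsPolyMap F) (hG : IsPolyMap G) : IsPolyMap fun x => F x - G x := by
  simpa [sub_eq_add_neg] using hF.add (hG.smul (-1))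

theorem mul (hF : IsPolyMap F) (hG : IsPolyMap G) : IsPolyMap fun x => F x * G x := by
  intro i j
  choose p hp using hF
  choose q hq using hG
  refine ⟨∑ k, p i k * q k j, fun x => ?_⟩
  rw [LinearMap.toMatrix_mul, Matrix.mul_apply, map_sum]
  exact Finset.sum_congr rfl fun k _ => by rw [map_mul, hp, hq]

theorem sum {ι : Type*} (s : Finset ι) {F : ι → A → Module.End K V} (h : ∀ i, IsPolyMap (F i)) :
    IsPolyMap fun x => ∑ i ∈ s, F i x := by
  classical
  induction s using Finset.induction_on with
  | empty => simpa using isPolyMap_const (A := A) (0 : Module.End K V)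
  | insert a s ha ih => simpa [Finset.sum_insert ha] using (h a).add ih

theorem pow (hF : IsPolyMap F) (n : ℕ) : IsPolyMap fun x => F x ^ n := by
  induction n with
  | zero => simpa using isPolyMap_const (A := A) (1 : Module.End K V)
  | succ n ih => simpa [pow_succ] using ih.mul hF

theorem aeval (hF : IsPolyMap F) (q : Polynomial K) :
    IsPolyMap fun x => Polynomial.aeval (F x) q := by
  simp only [Polynomial.aeval_eq_sum_range]
  exact IsPolyMap.sum _ fun i => (hF.pow i).smul _

theorem proj (hF : IsPolyMap F) (B : ℕ) (j : ℤ) : IsPolyMap fun x => proj B (F x) j := by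
  unfold DeligneSys.proj
  split_ifs
  · exact hF.aeval _
  · exact isPolyMap_const 0

end IsPolyMap

/-- The common zero locus of a set of polynomials. -/
def IsZariskiClosed (S : Set A) : Prop :=
  ∃ P : Set (MvPolynomial (Fin (Module.finrank K A)) K),
    ∀ x, x ∈ S ↔ ∀ p ∈ P, MvPolynomial.eval ((Module.finBasis K A).equivFun x) p = 0

theorem IsZariskiClosed.isAlgebraicSubvariety {S : Set A} (h : IsZariskiClosed (K := K) S) :
    IsAlgebraicSubvariety (K := K) S := by
  obtain ⟨P, hP⟩ := h
  refine ⟨Ideal.span P, ?_⟩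
  rw [MvPolynomial.zeroLocus_span]
  ext y
  constructor
  · rintro ⟨x, hx, rfl⟩ p hp
    rw [MvPolynomial.aeval_eq_eval]
    exact (hP x).mp hx p hp
  · intro hy
    refine ⟨(Module.finBasis K A).equivFun.symm y, (hP _).mpr fun p hp => ?_,
      LinearEquiv.apply_symm_apply _ y⟩
    rw [LinearEquiv.apply_symm_apply, ← MvPolynomial.aeval_eq_eval]
    exact hy p hp

theorem isAlgebraicSubvariety_empty : IsAlgebraicSubvariety (K := K) (∅ : Set A) :=
  IsZariskiClosed.isAlgebraicSubvariety ⟨{1}, fun x => by simp⟩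

theorem IsZariskiClosed.forall {ι : Sort*} {Q : ι → A → Prop}
    (h : ∀ i, IsZariskiClosed (K := K) {x | Q i x}) :
    IsZariskiClosed (K := K) {x | ∀ i, Q i x} := by
  choose P hP using h
  refine ⟨⋃ i, P i, fun x => ?_⟩
  simp only [Set.mem_iUnion, Set.mem_ofPred_eq] at hP ⊢
  constructor
  · rintro hx p ⟨i, hp⟩
    exact (hP i x).mp (hx i) p hp
  · exact fun hx i => (hP i x).mpr fun p hp => hx p ⟨i, hp⟩

theorem IsZariskiClosed.and {Q Q' : A → Prop} (h : IsZariskiClosed (K := K) {x | Q x})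
    (h' : IsZariskiClosed (K := K) {x | Q' x}) : IsZariskiClosed (K := K) {x | Q x ∧ Q' x} := by
  obtain ⟨P, hP⟩ := h
  obtain ⟨P', hP'⟩ := h'
  refine ⟨P ∪ P', fun x => ?_⟩
  simp only [Set.mem_ofPred_eq] at hP hP' ⊢
  rw [hP, hP']
  simp only [Set.mem_union, or_imp, forall_and]

theorem IsPolyMap.isZariskiClosed {F : A → Module.End K V} (hF : IsPolyMap F) :
    IsZariskiClosed (K := K) {x | F x = 0} := by
  choose p hp using hF
  refine ⟨Set.range fun ij : _ × _ => p ij.1 ij.2, fun x => ?_⟩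
  rw [Set.forall_mem_range, Set.mem_ofPred_eq,
    ← (LinearMap.toMatrix (Module.finBasis K V) (Module.finBasis K V)).map_eq_zero_iff,
    ← Matrix.ext_iff]
  constructor
  · intro h ij
    rw [hp]
    exact h ij.1 ij.2
  · intro h i j
    rw [← hp]
    exact h (i, j)

end Zariski
end DeligneSys

namespace DeligneSys

/-! ### The polynomial equations of the systems of given `sl₂`-type. -/

section Main

variable {K : Type*} [Field K] {V : Type*} [AddCommGroup V] [Module K V]

/-- In finite dimension an `sl₂`-triple is determined by two of its elements. -/
theorem IsSl2Rep.unique [CharZero K] [FiniteDimensional K V] {F H E E' : Module.End K V}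
    (h : IsSl2Rep F H E) (h' : IsSl2Rep F H E') : E = E' := by
  have h1 := h.lie_cartan_pos
  have h2 := h'.lie_cartan_pos
  have h3 := h.lie_pos_neg.trans h'.lie_pos_neg.symm
  rw [Ring.lie_def] at h1 h2
  rw [Ring.lie_def, Ring.lie_def] at h3
  -- The difference of two candidates commutes with `F` and has weight 2.
  refine sub_eq_zero.mp ((h.hom h).eq_zero_of_pos (k := 1) ?_ ?_)
  · change H * (E - E') - (E - E') * H = _
    rw [show H * (E - E') - (E - E') * H = (H * E - E * H) - (H * E' - E' * H) by noncomm_ring,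
      h1, h2, ← smul_sub]
    norm_num
  · have : homAd F F (E - E') = 0 := by
      change F * (E - E') - (E - E') * F = 0
      rw [show F * (E - E') - (E - E') * F = (E' * F - F * E') - (E * F - F * E) by noncomm_ring,
        h3, sub_self]
    rw [this, map_zero]

theorem IsGrading.stable_iff [CharZero K] {B : ℕ} {Y : Module.End K V} {W : ℤ → Submodule K V}
    (h : IsGrading Y W) (hY : IsBounded B Y) (A : Module.End K V) :
    (∀ k, ∀ x ∈ W k, A x ∈ W k) ↔ ∀ a b, b < a → proj B Y a * A * proj B Y b = 0 := by
  simpa using h.map_mem_iff hY A 0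

theorem IsGrading.lowers_iff [CharZero K] {B : ℕ} {Y : Module.End K V} {W : ℤ → Submodule K V}
    (h : IsGrading Y W) (hY : IsBounded B Y) (A : Module.End K V) :
    (∀ k, ∀ x ∈ W k, A x ∈ W (k - 2)) ↔ ∀ a b, b - 2 < a → proj B Y a * A * proj B Y b = 0 := by
  simpa [sub_eq_add_neg] using h.map_mem_iff hY A (-2)

variable {r : ℕ}

/-- The grading `Y^k` of a Deligne system of given `sl₂`-type, in terms of `Y = Y^r`. -/
noncomputable def gradingAt (H : Fin r → Module.End K V) (Y : Module.End K V) (k : Fin (r + 1)) :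
    Module.End K V :=
  Y - ∑ i with k ≤ i.castSucc, H i

theorem gradingAt_last (H : Fin r → Module.End K V) (Y : Module.End K V) :
    gradingAt H Y (Fin.last r) = Y := by
  rw [gradingAt, Finset.sum_eq_zero, sub_zero]
  intro i hi
  rw [Finset.mem_filter] at hi
  exact absurd hi.2 (not_le.mpr i.castSucc_lt_last)

theorem gradingAt_succ_sub (H : Fin r → Module.End K V) (Y : Module.End K V) (j : Fin r) :
    gradingAt H Y j.succ - gradingAt H Y j.castSucc = H j := by
  have : (Finset.univ.filter fun i : Fin r => j.castSucc ≤ i.castSucc) =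
      insert j (Finset.univ.filter fun i : Fin r => j.succ ≤ i.castSucc) := by
    ext i
    simp only [Finset.mem_filter, Finset.mem_univ, true_and, Finset.mem_insert, Fin.le_def,
      Fin.ext_iff, Fin.val_castSucc, Fin.val_succ]
    omega
  rw [gradingAt, gradingAt, this, Finset.sum_insert]
  · abel
  · simp [Fin.le_def]

theorem eq_gradingAt {H : Fin r → Module.End K V} {Ys : Fin (r + 1) → Module.End K V}
    (h : ∀ j : Fin r, H j = Ys j.succ - Ys j.castSucc) (k : Fin (r + 1)) :
    Ys k = gradingAt H (Ys (Fin.last r)) k := by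
  induction k using Fin.reverseInduction with
  | last => rw [gradingAt_last]
  | cast j ih =>
    have h1 := gradingAt_succ_sub H (Ys (Fin.last r)) j
    rw [← ih, h j] at h1
    exact (sub_right_injective h1).symm

/-- The equations of the Deligne systems of given `sl₂`-type in `End(V)^r × End(V)`. Here `e l` is
a projector onto `W l`, and `E j` completes `Nhat j` and `H j` to an `sl₂`-triple. -/
def DeligneEquations (B : ℕ) (e : ℤ → Module.End K V) (Nhat H E : Fin r → Module.End K V)
    (p : (Fin r → Module.End K V) × Module.End K V) : Prop :=
  (∀ k, IsBounded B (gradingAt H p.2 k)) ∧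
  -- These two lines say that `W l` is contained in, and contains, the `l`-th step of the filtration
  -- defined by the grading `Y^0`.
  (∀ l j, l < j → proj B (gradingAt H p.2 0) j * e l = 0) ∧
  (∀ l j, j ≤ l → (1 - e l) * proj B (gradingAt H p.2 0) j = 0) ∧
  (∀ j, p.1 j ^ Module.finrank K V = 0) ∧
  (∀ i j, p.1 i * p.1 j - p.1 j * p.1 i = 0) ∧
  (∀ j k a b, b < a →
    proj B (gradingAt H p.2 k) a * p.1 j * proj B (gradingAt H p.2 k) b = 0) ∧
  (∀ (j : Fin r) (k : Fin (r + 1)), j.succ ≤ k → ∀ a b, b - 2 < a →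
    proj B (gradingAt H p.2 k) a * p.1 j * proj B (gradingAt H p.2 k) b = 0) ∧
  (∀ k a b, b < a →
    proj B (gradingAt H p.2 k) a * p.2 * proj B (gradingAt H p.2 k) b = 0) ∧
  (∀ j, p.2 * p.1 j - p.1 j * p.2 - (-2 : K) • p.1 j = 0) ∧
  (∀ j : Fin r, gradingAt H p.2 j.castSucc * gradingAt H p.2 j.succ -
    gradingAt H p.2 j.succ * gradingAt H p.2 j.castSucc = 0) ∧
  (∀ j : Fin r, Nhat j - ∑ b ∈ window B, proj B (gradingAt H p.2 j.castSucc) b *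
    p.1 j * proj B (gradingAt H p.2 j.castSucc) b = 0) ∧
  (∀ j, (p.1 j - Nhat j) * E j - E j * (p.1 j - Nhat j) = 0) ∧
  -- The last three families replace the condition on relative weight filtrations of restrictions:
  -- `Y^{j-1}`, `Y^j` and `E j` preserve the earlier filtrations `W^k`.
  (∀ (j : Fin r) (k : Fin (r + 1)), k < j.castSucc → ∀ a b, b < a →
    proj B (gradingAt H p.2 k) a * gradingAt H p.2 j.castSucc * proj B (gradingAt H p.2 k) b = 0) ∧
  (∀ (j : Fin r) (k : Fin (r + 1)), k < j.castSucc → ∀ a b, b < a →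
    proj B (gradingAt H p.2 k) a * gradingAt H p.2 j.succ * proj B (gradingAt H p.2 k) b = 0) ∧
  (∀ (j : Fin r) (k : Fin (r + 1)), k < j.castSucc → ∀ a b, b < a →
    proj B (gradingAt H p.2 k) a * E j * proj B (gradingAt H p.2 k) b = 0)

theorem IsPolyMap.deligneEquations [FiniteDimensional K V] {A : Type*} [AddCommGroup A]
    [Module K A] [FiniteDimensional K A] (B : ℕ) (e : ℤ → Module.End K V)
    (Nhat H E : Fin r → Module.End K V) {N : Fin r → A → Module.End K V} {Y : A → Module.End K V}
    (hN : ∀ j, IsPolyMap (N j)) (hY : IsPolyMap Y) :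
    IsZariskiClosed (K := K) {x : A | DeligneEquations B e Nhat H E (fun j => N j x, Y x)} := by
  have hc : ∀ C : Module.End K V, IsPolyMap fun _ : A => C := isPolyMap_const
  have hG : ∀ k, IsPolyMap fun x : A => gradingAt H (Y x) k := fun k => hY.sub (hc _)
  have hp : ∀ k a, IsPolyMap fun x : A => DeligneSys.proj B (gradingAt H (Y x) k) a :=
    fun k a => (hG k).proj B a
  have hconj : ∀ k a b {F : A → Module.End K V}, IsPolyMap F → IsZariskiClosed (K := K)
      {x | DeligneSys.proj B (gradingAt H (Y x) k) a * F x *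
        DeligneSys.proj B (gradingAt H (Y x) k) b = 0} :=
    fun k a b _ hF => (((hp k a).mul hF).mul (hp k b)).isZariskiClosed
  exact .and (.forall fun k => ((hG k).aeval _).isZariskiClosed) <|
    .and (.forall fun l => .forall fun j => .forall fun _ =>
      ((hp 0 j).mul (hc _)).isZariskiClosed) <|
    .and (.forall fun l => .forall fun j => .forall fun _ =>
      ((hc _).mul (hp 0 j)).isZariskiClosed) <|
    .and (.forall fun j => ((hN j).pow _).isZariskiClosed) <|
    .and (.forall fun i => .forall fun j =>
      (((hN i).mul (hN j)).sub ((hN j).mul (hN i))).isZariskiClosed) <|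
    .and (.forall fun j => .forall fun k => .forall fun a => .forall fun b =>
      .forall fun _ => hconj k a b (hN j)) <|
    .and (.forall fun j => .forall fun k => .forall fun _ =>
      .forall fun a => .forall fun b =>
      .forall fun _ => hconj k a b (hN j)) <|
    .and (.forall fun k => .forall fun a => .forall fun b => .forall fun _ => hconj k a b hY) <|
    .and (.forall fun j =>
      (((hY.mul (hN j)).sub ((hN j).mul hY)).sub ((hN j).smul _)).isZariskiClosed) <|
    .and (.forall fun j => (((hG _).mul (hG _)).sub ((hG _).mul (hG _))).isZariskiClosed) <|
    .and (.forall fun j => ((hc _).sub (IsPolyMap.sum _ fun b =>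
      ((hp _ b).mul (hN j)).mul (hp _ b))).isZariskiClosed) <|
    .and (.forall fun j => ((((hN j).sub (hc _)).mul (hc _)).sub
      ((hc _).mul ((hN j).sub (hc _)))).isZariskiClosed) <|
    .and (.forall fun j => .forall fun k => .forall fun _ =>
      .forall fun a => .forall fun b =>
      .forall fun _ => hconj k a b (hG _)) <|
    .and (.forall fun j => .forall fun k => .forall fun _ =>
      .forall fun a => .forall fun b =>
      .forall fun _ => hconj k a b (hG _)) <|
    .forall fun j => .forall fun k => .forall fun _ =>
      .forall fun a => .forall fun b =>
      .forall fun _ => hconj k a b (hc _)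

theorem isZariskiClosed_deligneEquations [FiniteDimensional K V] (B : ℕ) (e : ℤ → Module.End K V)
    (Nhat H E : Fin r → Module.End K V) :
    IsZariskiClosed (K := K) {p | DeligneEquations B e Nhat H E p} := by
  let Y : (Fin r → Module.End K V) × Module.End K V →ₗ[K] Module.End K V :=
    LinearMap.snd K (Fin r → Module.End K V) (Module.End K V)
  let N (j : Fin r) : (Fin r → Module.End K V) × Module.End K V →ₗ[K] Module.End K V :=
    (LinearMap.proj j : (Fin r → Module.End K V) →ₗ[K] Module.End K V) ∘ₗ
      LinearMap.fst K (Fin r → Module.End K V) (Module.End K V)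
  exact IsPolyMap.deligneEquations B e Nhat H E (N := fun j => N j) (Y := Y)
    (fun j => isPolyMap_linear (N j)) (isPolyMap_linear Y)

end Main
end DeligneSys

namespace DeligneSys

/-! ### Equivalence of the equations with the definition. -/

section Main

variable {K : Type*} [Field K] [CharZero K] {V : Type*} [AddCommGroup V] [Module K V]
  [FiniteDimensional K V] {r : ℕ}

omit [CharZero K] [FiniteDimensional K V] in
theorem proj_zero_component_mem {B : ℕ} {Y N : Module.End K V} {U : Submodule K V}
    (hY : ∀ x ∈ U, Y x ∈ U) (hN : ∀ x ∈ U, N x ∈ U) :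
    ∀ x ∈ U, (∑ b ∈ window B, proj B Y b * N * proj B Y b) x ∈ U := by
  intro x hx
  rw [LinearMap.sum_apply]
  exact U.sum_mem fun b _ => proj_mem hY b (hN _ (proj_mem hY b hx))

/-- Each `W^k` is recovered as the filtration defined by the eigenspaces of `gradingAt H Y k`. Both
relative weight conditions then come from split `sl₂`-data, on `V` and restricted to `W^k_l`. -/
theorem DeligneEquations.isDeligneSystemOfType {B : ℕ} {W : ℤ → Submodule K V}
    {e : ℤ → Module.End K V} {Nhat H E : Fin r → Module.End K V}
    {p : (Fin r → Module.End K V) × Module.End K V}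
    (he : ∀ l x, e l x ∈ W l) (he' : ∀ l, ∀ x ∈ W l, e l x = x)
    (hE : ∀ j, IsSl2Rep (Nhat j) (H j) (E j)) (h : DeligneEquations B e Nhat H E p) :
    IsDeligneSystemOfType W Nhat H p.1 p.2 := by
  obtain ⟨N, Y⟩ := p
  obtain ⟨bounded, le_zero, zero_le, nilpotent, commute, stable, lowers, grading_stable,
    grading_lie, grading_commute, zeroComponent, deligne, restrict_left, restrict_right,
    restrict_pos⟩ := h
  dsimp only at *
  set Ys : Fin (r + 1) → Module.End K V := gradingAt H Y with hYs
  let Ws : Fin (r + 1) → ℤ → Submodule K V := fun k l =>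
    ⨆ j : ℤ, ⨆ _ : j ≤ l, Module.End.eigenspace (Ys k) (j : K)
  have hg : ∀ k, IsGrading (Ys k) (Ws k) := fun k => ⟨(bounded k).iSup_eigenspace, fun _ => rfl⟩
  have hlast : Ys (Fin.last r) = Y := gradingAt_last H Y
  have hH : ∀ j : Fin r, H j = Ys j.succ - Ys j.castSucc :=
    fun j => (gradingAt_succ_sub H Y j).symm
  have hstab : ∀ (A : Module.End K V) k, (∀ a b, b < a →
      proj B (Ys k) a * A * proj B (Ys k) b = 0) → ∀ l, ∀ x ∈ Ws k l, A x ∈ Ws k l :=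
    fun A k => ((hg k).stable_iff (bounded k) A).mpr
  have hN := fun j k => hstab (N j) k (stable j k)
  have hlow : ∀ (j : Fin r) (k : Fin (r + 1)), j.succ ≤ k →
      ∀ l, ∀ x ∈ Ws k l, N j x ∈ Ws k (l - 2) :=
    fun j k hjk => ((hg k).lowers_iff (bounded k) (N j)).mpr (lowers j k hjk)
  have hcomm : ∀ j : Fin r, Commute (Ys j.castSucc) (Ys j.succ) :=
    fun j => sub_eq_zero.mp (grading_commute j)
  have hNhat : ∀ j : Fin r, Nhat j = ∑ b ∈ window B,
      proj B (Ys j.castSucc) b * N j * proj B (Ys j.castSucc) b :=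
    fun j => sub_eq_zero.mp (zeroComponent j)
  have hzero : ∀ j : Fin r, IsZeroComponent (Ys j.castSucc) (N j) (Nhat j) := by
    intro j
    rw [hNhat j]
    exact isZeroComponent_sum (bounded _) (N j)
  have hsl2 : ∀ j : Fin r, IsSl2Rep (Nhat j) (Ys j.succ - Ys j.castSucc) (E j) := by
    intro j
    rw [← hH j]
    exact hE j
  have hsplit : ∀ j : Fin r, IsSplitSl2 B (Ws j.castSucc) (Ws j.succ) (N j) (Nhat j) (E j)
      (Ys j.castSucc) (Ys j.succ) := by
    intro j
    obtain ⟨h1, h2⟩ := IsSplitSl2.lead_of_isZeroComponent (hg j.castSucc) (bounded _)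
      (hN j j.castSucc) (hzero j)
    exact ⟨hg _, hg _, bounded _, bounded _, hcomm j, h1, hsl2 j, hN j _, h2⟩
  refine ⟨Ws, Ys, ?_, ?_, hlast, fun j => ⟨⟨hg _, hcomm j, Nhat j, E j, hzero j, hsl2 j, ?_⟩,
    hzero j, hH j⟩⟩
  · funext l
    ext x
    rw [(hg 0).mem_iff (bounded 0)]
    constructor
    · intro hx
      rw [← sum_proj_apply B (Ys 0) x]
      refine Submodule.sum_mem _ fun j _ => ?_
      by_cases hj : j ≤ l
      · have h1 := LinearMap.congr_fun (zero_le l j hj) x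
        rw [Module.End.mul_apply, LinearMap.sub_apply, Module.End.one_apply,
          LinearMap.zero_apply, sub_eq_zero] at h1
        rw [h1]
        exact he l _
      · rw [hx j (by omega)]
        exact Submodule.zero_mem _
    · intro hx j hj
      have h1 := LinearMap.congr_fun (le_zero l j hj) x
      rwa [Module.End.mul_apply, he' l x hx] at h1
  · refine ⟨fun k => (hg k).isFiltration (bounded k), ?_, fun j => ⟨_, nilpotent j⟩,
      fun i j => sub_eq_zero.mp (commute i j),
      fun j => (hsplit j).isRelativeWeightFiltration (hlow j _ le_rfl), fun j k => hN j k,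
      fun j k l hjk => hlow j k hjk l, fun j k l hk => ?_, fun k => hstab Y k (grading_stable k),
      fun j => sub_eq_zero.mp (grading_lie j)⟩
    · have := hg (Fin.last r)
      rwa [hlast] at this
    · have hYc := hstab _ k (restrict_left j k hk) l
      -- Stability of `W^k_l` under `Nhat j` needs no equation of its own: `Nhat j` is built from `N
      -- j` and the projectors of `Y^{j-1}`, which preserve it.
      refine ((hsplit j).restrict (hN j k l) ?_ (hstab _ k (restrict_pos j k hk) l) hYc
        (hstab _ k (restrict_right j k hk) l)).isRelativeWeightFiltration
        fun m x hx => hlow j _ le_rfl m _ hx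
      rw [hNhat j]
      exact proj_zero_component_mem hYc (hN j k l)
  · exact deligne j

/-- The gradings of a Deligne system have eigenvalues bounded in terms of its `sl₂`-type. -/
theorem isBounded_of_isDeligneGrading {B C : ℕ} {H N : Fin r → Module.End K V}
    {Ws : Fin (r + 1) → ℤ → Submodule K V} {Ys : Fin (r + 1) → Module.End K V}
    (h₁ : Ws 0 (-(B : ℤ) - 1) = ⊥) (h₂ : Ws 0 B = ⊤) (h₀ : IsGrading (Ys 0) (Ws 0))
    (hC : ∀ j, IsBounded C (H j))
    (h : ∀ j : Fin r, IsDeligneGrading (Ws j.castSucc) (N j) (Ys j.succ) (Ys j.castSucc))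
    (hH : ∀ j : Fin r, H j = Ys j.succ - Ys j.castSucc) (k : Fin (r + 1)) :
    IsBounded (B + r * C) (Ys k) := by
  suffices IsBounded (B + (k : ℕ) * C) (Ys k) from
    this.mono (Nat.add_le_add_left (Nat.mul_le_mul_right C (Nat.le_of_lt_succ k.2)) B)
  induction k using Fin.induction with
  | zero => simpa using h₀.isBounded_of_filtration h₁ h₂
  | succ j ih =>
    have hc : Commute (Ys j.castSucc) (H j) := by
      rw [hH j]
      exact (h j).2.1.sub_right (Commute.refl _)
    have e : Ys j.succ = Ys j.castSucc + H j := by rw [hH j]; abel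
    rw [e, Fin.val_succ, add_mul, one_mul, ← add_assoc]
    exact ih.add (hC j) hc

theorem deligneEquations_of_isDeligneSystemOfType {B C : ℕ} {W : ℤ → Submodule K V}
    {e : ℤ → Module.End K V} {Nhat H E : Fin r → Module.End K V}
    {p : (Fin r → Module.End K V) × Module.End K V}
    (he : ∀ l x, e l x ∈ W l) (he' : ∀ l, ∀ x ∈ W l, e l x = x)
    (hE : ∀ j, IsSl2Rep (Nhat j) (H j) (E j))
    (h₁ : W (-(B : ℤ) - 1) = ⊥) (h₂ : W B = ⊤) (hC : ∀ j, IsBounded C (H j))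
    (h : IsDeligneSystemOfType W Nhat H p.1 p.2) :
    DeligneEquations (B + r * C) e Nhat H E p := by
  obtain ⟨N, Y⟩ := p
  obtain ⟨Ws, Ys, rfl, hd, hlast, hj⟩ := h
  dsimp only at *
  have hYs : ∀ k, gradingAt H Y k = Ys k := by
    intro k
    rw [← hlast]
    exact (eq_gradingAt (fun j => (hj j).2.2) k).symm
  have hg : ∀ k, IsGrading (Ys k) (Ws k) := by
    intro k
    induction k using Fin.lastCases with
    | last => rw [hlast]; exact hd.grading
    | cast j => exact (hj j).1.1
  have hB := isBounded_of_isDeligneGrading h₁ h₂ (hg 0) hC (fun j => (hj j).1)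
    (fun j => (hj j).2.2)
  generalize B + r * C = D at hB ⊢
  have hsl2 : ∀ j : Fin r, IsSl2Rep (Nhat j) (Ys j.succ - Ys j.castSucc) (E j) := by
    intro j
    rw [← (hj j).2.2]
    exact hE j
  have hdel : ∀ j, ⁅N j - Nhat j, E j⁆ = 0 := by
    intro j
    obtain ⟨⟨-, -, N₀, Np, h0, h1, h2⟩, h3, -⟩ := hj j
    have e1 : N₀ = Nhat j := (h0.eq_sum (hB _)).trans (h3.eq_sum (hB _)).symm
    subst e1
    -- The definition allows any completion of the pair to an `sl₂`-triple; uniqueness identifies it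
    -- with the fixed `E j`.
    rwa [← h1.unique (hsl2 j)]
  have hsplit : ∀ j : Fin r, IsSplitSl2 D (Ws j.castSucc) (Ws j.succ) (N j) (Nhat j) (E j)
      (Ys j.castSucc) (Ys j.succ) := by
    intro j
    obtain ⟨h1, h2⟩ := IsSplitSl2.lead_of_isZeroComponent (hg j.castSucc) (hB _)
      (hd.stable j j.castSucc) (hj j).2.1
    exact ⟨hg _, hg _, hB _, hB _, (hj j).1.2.1, h1, hsl2 j, hd.stable j _, h2⟩
  have hstep : ∀ j k, (∀ l, ∀ x ∈ Ws k l, Ys j.succ x ∈ Ws k l) → k < j.castSucc → ∀ l,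
      (∀ x ∈ Ws k l, Ys j.castSucc x ∈ Ws k l) ∧ ∀ x ∈ Ws k l, E j x ∈ Ws k l :=
    fun j k h hk l => (hsplit j).stable_of_restrict (hdel j) (hd.stable j k l) (h l)
      (hd.relative_restrict j k l hk)
  -- Descending induction from `Y^r`, which preserves every `W^k` by assumption. The case `k = j` is
  -- immediate, as `Y^j` grades `W^j`; for `k < j`, compatibility of Deligne's grading with `W^k_l`
  -- carries stability from `Y^{j+1}` to `Y^j`.
  have hstab : ∀ j k, k ≤ j → ∀ l, ∀ x ∈ Ws k l, Ys j x ∈ Ws k l := by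
    intro j
    induction j using Fin.reverseInduction with
    | last =>
      intro k _
      rw [hlast]
      exact hd.grading_stable k
    | cast j ih =>
      intro k hk l
      rcases hk.eq_or_lt with rfl | hk
      · exact fun x hx => (hg _).map_mem (Commute.refl _) hx
      · exact (hstep j k (ih k (hk.trans (Fin.castSucc_lt_succ)).le) hk l).1
  have hstab' : ∀ (j : Fin r) k, k < j.castSucc → ∀ l, ∀ x ∈ Ws k l, Ys j.succ x ∈ Ws k l :=
    fun j k hk => hstab j.succ k (hk.trans (Fin.castSucc_lt_succ)).le
  have hiff : ∀ (A : Module.End K V) k, (∀ l, ∀ x ∈ Ws k l, A x ∈ Ws k l) → ∀ a b, b < a →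
      proj D (Ys k) a * A * proj D (Ys k) b = 0 :=
    fun A k => ((hg k).stable_iff (hB k) A).mp
  refine ⟨?_, ?_, ?_, ?_, ?_, ?_, ?_, ?_, ?_, ?_, ?_, ?_, ?_, ?_, ?_⟩ <;>
    simp only [hYs]
  · exact hB
  · intro l j hlj
    ext x
    exact ((hg 0).mem_iff (hB 0)).mp (he l x) j hlj
  · intro l j hjl
    ext x
    rw [Module.End.mul_apply, LinearMap.sub_apply, Module.End.one_apply,
      he' l _ ((hg 0).proj_mem (hB 0) hjl x), sub_self, LinearMap.zero_apply]
  · intro j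
    have h1 := IsNilpotent.charpoly_eq_X_pow_finrank (hd.nilpotent j)
    have h2 := (N j).aeval_self_charpoly
    rwa [h1, map_pow, Polynomial.aeval_X] at h2
  · exact fun i j => sub_eq_zero.mpr (hd.commute i j)
  · exact fun j k => hiff _ k (hd.stable j k)
  · exact fun j k hjk => ((hg k).lowers_iff (hB k) (N j)).mp fun l => hd.lowers j k l hjk
  · exact fun k => hiff _ k (hd.grading_stable k)
  · exact fun j => sub_eq_zero.mpr (hd.grading_lie j)
  · exact fun j => sub_eq_zero.mpr (hj j).1.2.1
  · exact fun j => sub_eq_zero.mpr ((hj j).2.1.eq_sum (hB _))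
  · exact hdel
  · exact fun j k hk => hiff _ k (hstab _ k hk.le)
  · exact fun j k hk => hiff _ k (hstab' j k hk)
  · exact fun j k hk => hiff _ k fun l => (hstep j k (hstab' j k hk) hk l).2

omit [CharZero K] [FiniteDimensional K V] in
theorem exists_filtration_bound {W : ℤ → Submodule K V} (h : IsFiltration W) :
    ∃ B : ℕ, W (-(B : ℤ) - 1) = ⊥ ∧ W B = ⊤ := by
  obtain ⟨a, ha⟩ := h.separated
  obtain ⟨b, hb⟩ := h.exhaustive
  refine ⟨a.natAbs + b.natAbs, ?_, ?_⟩
  · rw [eq_bot_iff, ← ha]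
    exact h.mono (by omega)
  · rw [eq_top_iff, ← hb]
    exact h.mono (by omega)

omit [CharZero K] [FiniteDimensional K V] in
theorem exists_projector (U : Submodule K V) :
    ∃ e : Module.End K V, (∀ x, e x ∈ U) ∧ ∀ x ∈ U, e x = x := by
  obtain ⟨f, hf⟩ := U.subtype.exists_leftInverse_of_injective U.ker_subtype
  exact ⟨U.subtype ∘ₗ f, fun x => (f x).2,
    fun x hx => congrArg Subtype.val (LinearMap.congr_fun hf ⟨x, hx⟩)⟩

end Main
end DeligneSys

theorem theorem6p55 {K : Type*} [Field K] [CharZero K]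
    {V : Type*} [AddCommGroup V] [Module K V] [FiniteDimensional K V]
    (r : ℕ) (W : ℤ → Submodule K V) (Nhat H : Fin r → Module.End K V) :
    DeligneSys.IsAlgebraicSubvariety (K := K)
      (DeligneSys.deligneSystemsOfType W Nhat H) := by
  open DeligneSys in
  -- A point supplies what the equations take as fixed data: the finiteness of `W`, an eigenvalue
  -- bound for the `H j`, and the completions `E j`. These involve only the `sl₂`-type, so they
  -- serve for every other point.
  rcases (deligneSystemsOfType W Nhat H).eq_empty_or_nonempty with h0 | ⟨p₀, hp₀⟩
  · rw [h0]
    exact isAlgebraicSubvariety_empty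
  choose e he he' using fun l => exists_projector (W l)
  obtain ⟨Ws, Ys, rfl, hd, hlast, hj⟩ := id hp₀
  obtain ⟨B, hB₁, hB₂⟩ := exists_filtration_bound (hd.filtration 0)
  have hg : ∀ k, IsGrading (Ys k) (Ws k) := by
    intro k
    induction k using Fin.lastCases with
    | last => rw [hlast]; exact hd.grading
    | cast j => exact (hj j).1.1
  have hY : ∀ k, ∃ C, IsBounded C (Ys k) := fun k => exists_isBounded (hg k).diagonalizable
  choose C hC using hY
  have hH : ∀ j, IsBounded (∑ k, (C k + C k)) (H j) := by
    intro j
    rw [(hj j).2.2]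
    have h1 : ∀ k, C k ≤ ∑ k, C k := fun k =>
      Finset.single_le_sum (fun _ _ => Nat.zero_le _) (Finset.mem_univ k)
    rw [Finset.sum_add_distrib]
    exact ((hC j.succ).mono (h1 _)).sub ((hC j.castSucc).mono (h1 _)) (hj j).1.2.1.symm
  have hE : ∀ j, ∃ E, IsSl2Rep (Nhat j) (H j) E := by
    intro j
    obtain ⟨⟨-, -, N₀, Np, h0, h1, -⟩, h3, h4⟩ := hj j
    rw [h3.eq_sum (hC _), ← h0.eq_sum (hC _), h4]
    exact ⟨Np, h1⟩
  choose E hE using hE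
  convert (isZariskiClosed_deligneEquations (B + r * ∑ k, (C k + C k)) e Nhat H
    E).isAlgebraicSubvariety using 1
  ext p
  exact ⟨deligneEquations_of_isDeligneSystemOfType he he' hE hB₁ hB₂ hH,
    DeligneEquations.isDeligneSystemOfType he he' hE⟩
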